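/- **Setting.** A state is $\mathbf U=(\rho,\mathbf m,\mathbf B,E)\in\mathbb R^8$ with $\rho,E\in\mathbb R$, $\mathbf m,\mathbf B\in\mathbb R^3$. Put $\mathbf v=\mathbf m/\rho$, $\mathcal E(\mathbf U)=E-\frac{|\mathbf m|^2}{2\rho}-\frac{|\mathbf B|^2}{2}$, $e=\mathcal E(\mathbf U)/\rho$, $p=p(\rho,e)$, where the equation of state satisfies, for $\rho>0$, $p(\rho,e)>0\Leftrightarrow e>0$. Let $G=\{\mathbf U:\rho>0,\ \mathcal E(\mathbf U)>0\}$. The ideal MHD fluxes ($i=1,2,3$) are $$\mathbf F_i(\mathbf U)=\Big(\rho v_i,\ v_i\mathbf m-B_i\mathbf B+(p+\tfrac12|\mathbf B|^2)\mathbf e_i,\ v_i\mathbf B-B_i\mathbf v,\ v_i(E+p+\tfrac12|\mathbf B|^2)-B_i(\mathbf v\cdot\mathbf B)\Big).$$ For $\mathbf U,\tilde{\mathbf U}\in G$ let $$\alpha_i(\mathbf U,\tilde{\mathbf U})=\max\Big\{|v_i|+\mathcal C_i,\ |\tilde v_i|+\tilde{\mathcal C}_i,\ \frac{|\sqrt\rho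 v_i+\sqrt{\tilde\rho}\tilde v_i|}{\sqrt\rho+\sqrt{\tilde\rho}}+\max\{\mathcal C_i,\tilde{\mathcal C}_i\}\Big\}+\frac{|\mathbf B-\tilde{\mathbf B}|}{\sqrt\rho+\sqrt{\tilde\rho}},$$ $$\mathcal C_i=\frac1{\sqrt2}\Big[\frac{|\mathbf B|^2}{\rho}+\mathcal C_s^2+\sqrt{\Big(\frac{|\mathbf B|^2}{\rho}+\mathcal C_s^2\Big)^2-4\frac{B_i^2\mathcal C_s^2}{\rho}}\Big]^{1/2},\qquad \mathcal C_s=\frac p{\rho\sqrt{2e}}.$$ Let $\mathbf n_1=(1,0,\dots,0)$ and, for $\mathbf v^*,\mathbf B^*\in\mathbb R^3$, $\mathbf n^*=(\tfrac12|\mathbf v^*|^2,-\mathbf v^*,-\mathbf B^*,1)$. **Meshes and quadrature.** Let $\Delta x,\Delta y>0$, $x_s=x_0+s\Delta x$, $y_s=y_0+s\Delta y$ for real $s$, and $I_{a,b}=(x_{a-1/2},x_{a+1/2})\times(y_{b-1/2},y_{b+1/2})$. The primal cells are $I_{i,j}$ and the dual cells $I_{i+1/2,j+1/2}$, $i,j\in\mathbb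 Z$. Let $k\ge0$, and let $\mathbf U_h^C$ (resp. $\mathbf U_h^D$) be an $\mathbb R^8$-valued function whose components on each primal (resp. dual) cell are polynomials of total degree at most $k$. Fix arbitrary sets of primal and of dual cells, those to be updated; all other cells only provide neighbouring (ghost) values, and either set may consist of all cells. Let $N=k+1$, $L=\lceil\frac{k+3}2\rceil$. Denote by $x_{a\pm1/4}^{(\mu)}$, $\omega_\mu$ ($1\le\mu\le N$) the Gauss nodes and by $\hat x_{a\pm1/4}^{(\nu)}$, $\hat\omega_\nu$ ($1\le\nu\le L$) the Gauss–Lobatto nodes, in increasing order, on $[x_{a-1/2},x_a]$ (sign $-$) and $[x_a,x_{a+1/2}]$ (sign $+$), with weights normalised to sum $1$; similarly in $y$. For a cell $I=I_{a,b}$ of one mesh let $\mathbf U$ be the solution on the same mesh and $\mathbf W$ the solution on the other mesh (so $\mathbf U=\mathbf U_h^C,\mathbf W=\mathbf U_h^D$ on primal cells and conversely on dual cells). $\mathbf W$ is polynomial on each of the four quarters of $I$; at nodes on the boundary of a quarter, the value of $\mathbf W$ at a node belonging to that quarter is the limit from within it. Let $\overline{\mathbf U}_{a,b},\overline{\mathbf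 W}_{a,b}$ be the averages over $I$, let $\Delta t>0$, $\theta=\Delta t/\tau_{\max}\in(0,1]$, and define $$\mathcal L_{a,b}=\frac{\overline{\mathbf W}_{a,b}-\overline{\mathbf U}_{a,b}}{\tau_{\max}}-\frac1{\Delta x}\sum_{\sigma=\pm1}\sum_{\mu=1}^N\frac{\omega_\mu}2\Big(\mathbf F_1(\mathbf W(x_{a+\frac12},y_{b+\frac\sigma4}^{(\mu)}))-\mathbf F_1(\mathbf W(x_{a-\frac12},y_{b+\frac\sigma4}^{(\mu)}))\Big)-\frac1{\Delta y}\sum_{\sigma=\pm1}\sum_{\mu=1}^N\frac{\omega_\mu}2\Big(\mathbf F_2(\mathbf W(x_{a+\frac\sigma4}^{(\mu)},y_{b+\frac12}))-\mathbf F_2(\mathbf W(x_{a+\frac\sigma4}^{(\mu)},y_{b-\frac12}))\Big),$$ the updated cell average $\mathbf U_{\Delta t}=\overline{\mathbf U}_{a,b}+\Delta t\,\mathcal L_{a,b}$ (written $\mathbf U^C_{\Delta t}$ on primal and $\mathbf U^D_{\Delta t}$ on dual cells), the discrete divergence, where $B_1,B_2$ are the magnetic components of $\mathbf W$ and $\mathbf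 B_h$ stands for its magnetic field, $$\mathrm{div}_{a,b}\mathbf B_h=\frac1{\Delta x}\sum_{\sigma=\pm1}\sum_{\mu=1}^N\frac{\omega_\mu}2\Big(B_1(x_{a+\frac12},y_{b+\frac\sigma4}^{(\mu)})-B_1(x_{a-\frac12},y_{b+\frac\sigma4}^{(\mu)})\Big)+\frac1{\Delta y}\sum_{\sigma=\pm1}\sum_{\mu=1}^N\frac{\omega_\mu}2\Big(B_2(x_{a+\frac\sigma4}^{(\mu)},y_{b+\frac12})-B_2(x_{a+\frac\sigma4}^{(\mu)},y_{b-\frac12})\Big),$$ and, for real $a_1,a_2$, with $\lambda_1=a_1\Delta t/\Delta x$, $\lambda_2=a_2\Delta t/\Delta y$, $\lambda=\lambda_1+\lambda_2$, $$\mathbf\Pi_{a,b}^{\nu,\pm}=\frac{\lambda_1}\lambda\sum_{\sigma=\pm1}\sum_{\mu=1}^N\frac{\omega_\mu}2\mathbf W(\hat x_{a\pm\frac14}^{(\nu)},y_{b+\frac\sigma4}^{(\mu)})+\frac{\lambda_2}\lambda\sum_{\sigma=\pm1}\sum_{\mu=1}^N\frac{\omega_\mu}2\mathbf W(x_{a+\frac\sigma4}^{(\mu)},\hat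 y_{b\pm\frac14}^{(\nu)}).$$ **Theorem 4.1.** Assume that for every updated cell $I_{a,b}$ (primal or dual): (i) $\overline{\mathbf U}_{a,b}\in G$; (ii) $\mathbf W\in G$ at all points $(x_{a+\sigma/4}^{(\mu)},\hat y_{b+\tau/4}^{(\nu)})$ and $(\hat x_{a+\sigma/4}^{(\nu)},y_{b+\tau/4}^{(\mu)})$, $\sigma,\tau=\pm1$, $1\le\mu\le N$, $1\le\nu\le L$; (iii) for all $\sigma=\pm1$ and $1\le\mu\le N$, $$a_1\ge\alpha_1\big(\mathbf W(x_{a+\frac12},y_{b+\frac\sigma4}^{(\mu)}),\mathbf W(x_{a-\frac12},y_{b+\frac\sigma4}^{(\mu)})\big),\qquad a_2\ge\alpha_2\big(\mathbf W(x_{a+\frac\sigma4}^{(\mu)},y_{b+\frac12}),\mathbf W(x_{a+\frac\sigma4}^{(\mu)},y_{b-\frac12})\big).$$ Assume the CFL condition $\lambda=\frac{a_1\Delta t}{\Delta x}+\frac{a_2\Delta t}{\Delta y}<\frac{\theta\hat\omega_1}2$. Then for all updated cells $I_{i,j}$, $I_{i+\frac12,j+\frac12}$ and all $\mathbf v^*,\mathbf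 B^*\in\mathbb R^3$, $$\mathbf U^C_{\Delta t}\cdot\mathbf n_1>0,\qquad\mathbf U^D_{\Delta t}\cdot\mathbf n_1>0,$$ $$\mathbf U^C_{\Delta t}\cdot\mathbf n^*+\frac{|\mathbf B^*|^2}2>\frac{\theta\hat\omega_1}2\Big((\mathbf\Pi_{i,j}^{L,-}+\mathbf\Pi_{i,j}^{1,+})\cdot\mathbf n^*+|\mathbf B^*|^2\Big)-\Delta t(\mathbf v^*\cdot\mathbf B^*)\,\mathrm{div}_{i,j}\mathbf B_h^D,$$ $$\mathbf U^D_{\Delta t}\cdot\mathbf n^*+\frac{|\mathbf B^*|^2}2>\frac{\theta\hat\omega_1}2\Big((\mathbf\Pi_{i+\frac12,j+\frac12}^{L,-}+\mathbf\Pi_{i+\frac12,j+\frac12}^{1,+})\cdot\mathbf n^*+|\mathbf B^*|^2\Big)-\Delta t(\mathbf v^*\cdot\mathbf B^*)\,\mathrm{div}_{i+\frac12,j+\frac12}\mathbf B_h^C.$$ If moreover $\mathrm{div}_{i,j}\mathbf B_h^D=0$ and $\mathrm{div}_{i+\frac12,j+\frac12}\mathbf B_h^C=0$ on all updated cells, then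 $\mathbf U^C_{\Delta t}\in G$ and $\mathbf U^D_{\Delta t}\in G$ on all updated cells. -/

import Mathlib

open scoped Matrix

noncomputable section

namespace CDG

/-! ### Ideal MHD: states, admissible set, fluxes, wave speeds -/

/-- Conservative vector `U = (ρ, m₁, m₂, m₃, B₁, B₂, B₃, E)`. -/
abbrev State := Fin 8 → ℝ

def density (U : State) : ℝ := U 0
def momentum (U : State) : Fin 3 → ℝ := ![U 1, U 2, U 3]
def magnetic (U : State) : Fin 3 → ℝ := ![U 4, U 5, U 6]
def energy (U : State) : ℝ := U 7

/-- Squared Euclidean length in `ℝ³`. -/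
def normSq (w : Fin 3 → ℝ) : ℝ := w ⬝ᵥ w

/-- Velocity `v = m / ρ`. -/
def velocity (U : State) : Fin 3 → ℝ := fun c => momentum U c / density U

/-- Internal energy `𝓔(U) = E - |m|² / (2ρ) - |B|² / 2 = ρ e`. -/
def internalEnergy (U : State) : ℝ :=
  energy U - normSq (momentum U) / (2 * density U) - normSq (magnetic U) / 2

/-- Specific internal energy `e`. -/
def specificEnergy (U : State) : ℝ := internalEnergy U / density U

/-- The set `G` of admissible states. -/
def admissible : Set State := {U | 0 < density U ∧ 0 < internalEnergy U}

/-- Thermal pressure for the equation of state `p = eos ρ e`. -/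
def pressure (eos : ℝ → ℝ → ℝ) (U : State) : ℝ := eos (density U) (specificEnergy U)

/-- Momentum component `c` of the flux in direction `i`. -/
def momentumFlux (eos : ℝ → ℝ → ℝ) (i : Fin 3) (U : State) (c : Fin 3) : ℝ :=
  velocity U i * momentum U c - magnetic U i * magnetic U c
    + (pressure eos U + normSq (magnetic U) / 2) * (if c = i then 1 else 0)

/-- Magnetic component `c` of the flux in direction `i`. -/
def magneticFlux (i : Fin 3) (U : State) (c : Fin 3) : ℝ :=
  velocity U i * magnetic U c - magnetic U i * velocity U c

/-- Energy component of the flux in direction `i`. -/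
def energyFlux (eos : ℝ → ℝ → ℝ) (i : Fin 3) (U : State) : ℝ :=
  velocity U i * (energy U + pressure eos U + normSq (magnetic U) / 2)
    - magnetic U i * (velocity U ⬝ᵥ magnetic U)

/-- The flux in the `i`-th coordinate direction (`i = 0, 1, 2`). -/
def flux (eos : ℝ → ℝ → ℝ) (i : Fin 3) (U : State) : State :=
  ![density U * velocity U i,
    momentumFlux eos i U 0, momentumFlux eos i U 1, momentumFlux eos i U 2,
    magneticFlux i U 0, magneticFlux i U 1, magneticFlux i U 2,
    energyFlux eos i U]

/-- `𝓒ₛ = p / (ρ √(2e))`. -/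
def soundSpeed (eos : ℝ → ℝ → ℝ) (U : State) : ℝ :=
  pressure eos U / (density U * √(2 * specificEnergy U))

/-- `𝓒ᵢ`, the fast-wave-like speed in direction `i`. -/
def fastSpeed (eos : ℝ → ℝ → ℝ) (i : Fin 3) (U : State) : ℝ :=
  1 / √2 * √(normSq (magnetic U) / density U + soundSpeed eos U ^ 2
    + √((normSq (magnetic U) / density U + soundSpeed eos U ^ 2) ^ 2
        - 4 * (magnetic U i ^ 2 * soundSpeed eos U ^ 2 / density U)))

/-- The wave-speed bound `αᵢ(U, V)` for a pair of states. -/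
def alpha (eos : ℝ → ℝ → ℝ) (i : Fin 3) (U V : State) : ℝ :=
  max (|velocity U i| + fastSpeed eos i U)
    (max (|velocity V i| + fastSpeed eos i V)
      (|√(density U) * velocity U i + √(density V) * velocity V i|
          / (√(density U) + √(density V))
        + max (fastSpeed eos i U) (fastSpeed eos i V)))
  + √(normSq (magnetic U - magnetic V)) / (√(density U) + √(density V))

/-- `n₁ = (1, 0, …, 0)`. -/
def n₁ : State := ![1, 0, 0, 0, 0, 0, 0, 0]

/-- `n* = (|v*|²/2, -v*, -B*, 1)`. -/
def nStar (v B : Fin 3 → ℝ) : State :=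
  ![normSq v / 2, -v 0, -v 1, -v 2, -B 0, -B 1, -B 2, 1]

/-! ### Gauss and Gauss–Lobatto quadrature on the reference interval `[0, 1]` -/

/-- The Legendre polynomial of degree `n`, transported to `[0, 1]`. -/
def legendre (n : ℕ) : Polynomial ℝ :=
  (Polynomial.shiftedLegendre n).map (Int.castRingHom ℝ)

/-- Nodes of the `N`-point Gauss rule on `[0, 1]`: the zeros of the Legendre polynomial. -/
def gaussNodes (N : ℕ) : Finset ℝ := (legendre N).roots.toFinset

/-- Nodes of the `L`-point Gauss–Lobatto rule on `[0, 1]` (`2 ≤ L`): the end points and the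
zeros of the derivative of the Legendre polynomial of degree `L - 1`. -/
def lobattoNodes (L : ℕ) : Finset ℝ :=
  {0, 1} ∪ (Polynomial.derivative (legendre (L - 1))).roots.toFinset

/-- The weight of the node `ξ` in the interpolatory quadrature rule on `[0, 1]` with node set `s`
(the integral of the Lagrange basis polynomial of `ξ`). -/
def quadWeight (s : Finset ℝ) (ξ : ℝ) : ℝ :=
  ∫ t in (0 : ℝ)..1, (Lagrange.basis s id ξ).eval t

/-- The Gauss nodes used with polynomial degree `k`: `N = k + 1`. -/
def gauss (k : ℕ) : Finset ℝ := gaussNodes (k + 1)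

/-- The Gauss weight `ω_μ`. -/
def gaussWeight (k : ℕ) (μ : ℝ) : ℝ := quadWeight (gauss k) μ

/-- The Gauss–Lobatto nodes used with polynomial degree `k`: `L = ⌈(k + 3) / 2⌉`.
The first node is `0`, the last one is `1`. -/
def lobatto (k : ℕ) : Finset ℝ := lobattoNodes ((k + 3) ⌈/⌉ 2)

/-- The first Gauss–Lobatto weight `ω̂₁`. -/
def lobattoWeight₁ (k : ℕ) : ℝ := quadWeight (lobatto k) 0

/-! ### Meshes and piecewise polynomials -/

/-- A uniform mesh, through a reference point `(x₀, y₀)` and the two step sizes. -/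
structure Mesh where
  x₀ : ℝ
  y₀ : ℝ
  dx : ℝ
  dy : ℝ
  dx_pos : 0 < dx
  dy_pos : 0 < dy

/-- The abscissa `x_s` for a (possibly fractional) index `s`. The primal cell `I_{i,j}` is
`(x_{i-1/2}, x_{i+1/2}) × (y_{j-1/2}, y_{j+1/2})`, the dual cell `I_{i+1/2,j+1/2}` is
`(x_i, x_{i+1}) × (y_j, y_{j+1})`. -/
def Mesh.x (M : Mesh) (s : ℝ) : ℝ := M.x₀ + s * M.dx

def Mesh.y (M : Mesh) (s : ℝ) : ℝ := M.y₀ + s * M.dy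

/-- A sign `σ = ±1` is encoded as a Boolean: `true` for `+1`, `false` for `-1`. -/
def sgn (σ : Bool) : ℝ := if σ then 1 else -1

/-- The image of the reference node `ξ ∈ [0, 1]` in the half-cell interval centred at `x_{a+σ/4}`,
i.e. in `[x_{a-1/2}, x_a]` for `σ = -1` and in `[x_a, x_{a+1/2}]` for `σ = +1`. -/
def Mesh.xNode (M : Mesh) (a : ℝ) (σ : Bool) (ξ : ℝ) : ℝ := M.x (a + sgn σ / 4 + (ξ - 1 / 2) / 2)

def Mesh.yNode (M : Mesh) (b : ℝ) (σ : Bool) (ξ : ℝ) : ℝ := M.y (b + sgn σ / 4 + (ξ - 1 / 2) / 2)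

/-- A vector of eight bivariate polynomials. -/
abbrev CellPoly := Fin 8 → MvPolynomial (Fin 2) ℝ

/-- The value of a vector of polynomials at the point `(x, y)`. -/
def CellPoly.val (P : CellPoly) (x y : ℝ) : State := fun c => MvPolynomial.eval ![x, y] (P c)

/-- Piecewise polynomials of total degree at most `k`, given by the polynomial on each cell.
For a function on the primal mesh, `(i, j)` stands for the cell `I_{i,j}`; for a function on the
dual mesh it stands for the cell `I_{i+1/2,j+1/2}`. -/
def DGSpace (k : ℕ) : Set (ℤ → ℤ → CellPoly) :=
  {U | ∀ i j c, (U i j c).totalDegree ≤ k}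

/-- On a cell of one mesh, the solution on the other mesh is one polynomial on each of the four
quarters of the cell; the quarter `(σ, τ)` is the one on the side `σ` of the centre in the
`x`-direction and on the side `τ` in the `y`-direction. At a point on the common boundary of
several quarters, `Q σ τ` gives the limit from within the quarter `(σ, τ)`. -/
abbrev Quarters := Bool → Bool → CellPoly

/-- The quarters of the primal cell `I_{i,j}`, with the dual-mesh solution: the quarter `(σ, τ)`
lies in the dual cell `I_{i+σ/2,j+τ/2}`. -/
def dualOnPrimal (UD : ℤ → ℤ → CellPoly) (i j : ℤ) : Quarters :=
  fun σ τ => UD (if σ then i else i - 1) (if τ then j else j - 1)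

/-- The quarters of the dual cell `I_{i+1/2,j+1/2}`, with the primal-mesh solution: the quarter
`(σ, τ)` lies in the primal cell `I_{i+(1+σ)/2,j+(1+τ)/2}`. -/
def primalOnDual (UC : ℤ → ℤ → CellPoly) (i j : ℤ) : Quarters :=
  fun σ τ => UC (if σ then i + 1 else i) (if τ then j + 1 else j)

/-! ### The cell-averaged scheme

In the following, `(a, b)` is the index of a cell of either mesh, so that the cell is
`(x_{a-1/2}, x_{a+1/2}) × (y_{b-1/2}, y_{b+1/2})`; `P` is the polynomial on this cell of the
solution on the same mesh, and `Q` the solution on the other mesh. -/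

/-- Average over the cell of the solution on the same mesh. -/
def ownAverage (M : Mesh) (a b : ℝ) (P : CellPoly) : State := fun c =>
  1 / (M.dx * M.dy) *
    ∫ x in M.x (a - 1 / 2)..M.x (a + 1 / 2), ∫ y in M.y (b - 1 / 2)..M.y (b + 1 / 2), P.val x y c

/-- Average over the cell of the solution on the other mesh (the four quarters added up). -/
def otherAverage (M : Mesh) (a b : ℝ) (Q : Quarters) : State := fun c =>
  1 / (M.dx * M.dy) * ∑ σ : Bool, ∑ τ : Bool,
    ∫ x in M.xNode a σ 0..M.xNode a σ 1, ∫ y in M.yNode b τ 0..M.yNode b τ 1, (Q σ τ).val x y c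

/-- Values of the other solution on the right (`s = true`) and left (`s = false`) edge
`x = x_{a±1/2}`, at the Gauss point `y_{b+σ/4}^{(μ)}`. -/
def xEdge (M : Mesh) (a b : ℝ) (Q : Quarters) (s σ : Bool) (μ : ℝ) : State :=
  (Q s σ).val (M.x (a + sgn s / 2)) (M.yNode b σ μ)

/-- Values of the other solution on the upper (`s = true`) and lower (`s = false`) edge
`y = y_{b±1/2}`, at the Gauss point `x_{a+σ/4}^{(μ)}`. -/
def yEdge (M : Mesh) (a b : ℝ) (Q : Quarters) (s σ : Bool) (μ : ℝ) : State :=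
  (Q σ s).val (M.xNode a σ μ) (M.y (b + sgn s / 2))

/-- The spatial operator `𝓛` of the cell-averaged central DG scheme of degree `k`. -/
def schemeOp (eos : ℝ → ℝ → ℝ) (M : Mesh) (k : ℕ) (τmax a b : ℝ) (P : CellPoly) (Q : Quarters) :
    State :=
  (1 / τmax) • (otherAverage M a b Q - ownAverage M a b P)
  - (1 / M.dx) • ∑ σ : Bool, ∑ μ ∈ gauss k, (gaussWeight k μ / 2) •
      (flux eos 0 (xEdge M a b Q true σ μ) - flux eos 0 (xEdge M a b Q false σ μ))
  - (1 / M.dy) • ∑ σ : Bool, ∑ μ ∈ gauss k, (gaussWeight k μ / 2) •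
      (flux eos 1 (yEdge M a b Q true σ μ) - flux eos 1 (yEdge M a b Q false σ μ))

/-- The updated cell average `Ū + Δt 𝓛`. -/
def updated (eos : ℝ → ℝ → ℝ) (M : Mesh) (k : ℕ) (Δt τmax a b : ℝ) (P : CellPoly)
    (Q : Quarters) : State :=
  ownAverage M a b P + Δt • schemeOp eos M k τmax a b P Q

/-- The discrete divergence on the cell of the magnetic field of the other solution. -/
def discreteDiv (M : Mesh) (k : ℕ) (a b : ℝ) (Q : Quarters) : ℝ :=
  1 / M.dx * ∑ σ : Bool, ∑ μ ∈ gauss k, gaussWeight k μ / 2 *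
      (magnetic (xEdge M a b Q true σ μ) 0 - magnetic (xEdge M a b Q false σ μ) 0)
  + 1 / M.dy * ∑ σ : Bool, ∑ μ ∈ gauss k, gaussWeight k μ / 2 *
      (magnetic (yEdge M a b Q true σ μ) 1 - magnetic (yEdge M a b Q false σ μ) 1)

/-- The states `Π^{ν,±}`, where `ν` is a Gauss–Lobatto node of `[0, 1]` and `s` the sign `±`. -/
def PiState (M : Mesh) (k : ℕ) (lam₁ lam₂ a b : ℝ) (Q : Quarters) (ν : ℝ) (s : Bool) : State :=
  (lam₁ / (lam₁ + lam₂)) • ∑ σ : Bool, ∑ μ ∈ gauss k, (gaussWeight k μ / 2) •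
      (Q s σ).val (M.xNode a s ν) (M.yNode b σ μ)
  + (lam₂ / (lam₁ + lam₂)) • ∑ σ : Bool, ∑ μ ∈ gauss k, (gaussWeight k μ / 2) •
      (Q σ s).val (M.xNode a σ μ) (M.yNode b s ν)

/-- The other solution is admissible at all points `Gauss ⊗ Lobatto` and `Lobatto ⊗ Gauss` of the
four quarters of the cell (with values from within the quarter). -/
def PointAdmissible (M : Mesh) (k : ℕ) (a b : ℝ) (Q : Quarters) : Prop :=
  ∀ σ τ : Bool, ∀ μ ∈ gauss k, ∀ ν ∈ lobatto k,
    (Q σ τ).val (M.xNode a σ μ) (M.yNode b τ ν) ∈ admissible ∧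
    (Q σ τ).val (M.xNode a σ ν) (M.yNode b τ μ) ∈ admissible

/-- `a₁` and `a₂` bound the wave speeds `α₁`, `α₂` for all pairs of opposite Gauss points on the
edges of the cell. -/
def SpeedBound (eos : ℝ → ℝ → ℝ) (M : Mesh) (k : ℕ) (a b : ℝ) (Q : Quarters) (a₁ a₂ : ℝ) : Prop :=
  ∀ σ : Bool, ∀ μ ∈ gauss k,
    alpha eos 0 (xEdge M a b Q true σ μ) (xEdge M a b Q false σ μ) ≤ a₁ ∧
    alpha eos 1 (yEdge M a b Q true σ μ) (yEdge M a b Q false σ μ) ≤ a₂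

end CDG

end

/-! Everything reduces to affine functionals `ℓ(U) = U · n + c`. By completing squares
(`dotProduct_nStar`), `U · n* + |B*|²/2` equals `ρ|v - v*|²/2 + 𝓔(U) + |B - B*|²/2`. It is positive
on `G` for all `v*`, `B*`, and choosing `v* = v`, `B* = B` gives back `𝓔(U)`. So the nonlinear
constraint becomes a family of affine ones, which pass through averages and flux sums.

The physical input is a splitting inequality for pairs of states
(`flux_sub_flux_dotProduct_nStar_le`): `(F_i(U) - F_i(V)) · n*` is at most `a (ℓ(U) + ℓ(V))` plus
the correction `(v*·B*)(B_i(U) - B_i(V))`. It rests on a spectral bound by the fast speed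
(`abs_coupling_le`) and on an estimate of the jump of `|B - B*|²` (`abs_magnetic_jump_le`). Summed
over opposite edges, the corrections form the discrete divergence.

The numerical input is a decomposition of the average of the other solution. Gauss and Gauss–Lobatto
tensor rules are exact for it, so it is the mean over both signs of the Lobatto averages of
`Π^{ν,±}` (`otherAverage_dotProduct`). Interior weights are nonnegative, so only the four end terms,
each of weight `θω̂₁/2`, need to be kept. The outer two, `Π^{L,+}` and `Π^{1,-}`, carry exactly the
edge values in the fluxes, whose contribution is at most `λ (ℓ(Π^{L,+}) + ℓ(Π^{1,-}))` apart from
the divergence. The CFL condition absorbs this strictly, and the inner two terms remain as the lower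
bound (`updated_dotProduct_gt`). -/

noncomputable section

/-! ### Gauss and Gauss–Lobatto rules: exactness, location of the nodes, signs of the weights. -/

namespace CDG

open Polynomial

/-! ### Integration of polynomials over `[0, 1]` -/

/-- The integral over `[0, 1]` as a linear functional on polynomials. -/
def unitIntegral : ℝ[X] →ₗ[ℝ] ℝ where
  toFun p := ∫ t in (0 : ℝ)..1, p.eval t
  map_add' p q := by
    simp only [eval_add]
    exact intervalIntegral.integral_add (p.continuous.intervalIntegrable _ _)
      (q.continuous.intervalIntegrable _ _)
  map_smul' c p := by simp

lemma unitIntegral_apply (p : ℝ[X]) : unitIntegral p = ∫ t in (0 : ℝ)..1, p.eval t := rfl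

lemma unitIntegral_derivative_mul (p q : ℝ[X]) :
    unitIntegral (derivative p * q)
      = p.eval 1 * q.eval 1 - p.eval 0 * q.eval 0 - unitIntegral (p * derivative q) := by
  have h := intervalIntegral.integral_mul_deriv_eq_deriv_mul (a := 0) (b := 1)
    (u := fun x => p.eval x) (v := fun x => q.eval x) (fun x _ => p.hasDerivAt x)
    (fun x _ => q.hasDerivAt x) ((derivative p).continuous.intervalIntegrable _ _)
    ((derivative q).continuous.intervalIntegrable _ _)
  simp only [unitIntegral_apply, eval_mul]
  rw [h]
  ring

lemma unitIntegral_nonneg {p : ℝ[X]} (hp : ∀ t ∈ Set.Icc (0 : ℝ) 1, 0 ≤ p.eval t) :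
    0 ≤ unitIntegral p :=
  intervalIntegral.integral_nonneg zero_le_one hp

lemma unitIntegral_one : unitIntegral 1 = 1 := by simp [unitIntegral_apply]

/-! ### Exactness of interpolatory quadrature -/

/-- An interpolatory rule whose nodal polynomial is orthogonal to all polynomials of degree below
`m` is exact in degrees below `#s + m`. -/
theorem unitIntegral_eq_sum_quadWeight (s : Finset ℝ) (m : ℕ)
    (horth : ∀ q : ℝ[X], q.degree < m → unitIntegral (Lagrange.nodal s id * q) = 0)
    (f : ℝ[X]) (hf : f.degree < (s.card + m : ℕ)) :
    unitIntegral f = ∑ ξ ∈ s, quadWeight s ξ * f.eval ξ := by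
  -- Divide `f` by the nodal polynomial `w`: the quotient has degree below `m`, so its multiple of
  -- `w` integrates to zero. The remainder agrees with `f` on `s` and equals its own interpolant.
  set w := Lagrange.nodal s (id : ℝ → ℝ) with hw
  have hmon : w.Monic := Lagrange.nodal_monic
  have hdeg : w.natDegree = s.card := Lagrange.natDegree_nodal
  have hr : (f %ₘ w).degree < s.card := by
    have := degree_modByMonic_lt f hmon
    rwa [hw, Lagrange.degree_nodal] at this
  have hq : (f /ₘ w).degree < m := by
    rcases eq_or_ne (f /ₘ w) 0 with h0 | h0
    · rw [h0, degree_zero]; exact WithBot.bot_lt_coe m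
    · have hf0 : f ≠ 0 := by rintro rfl; simp at h0
      rw [degree_eq_natDegree hf0] at hf
      have hf' : f.natDegree < s.card + m := by exact_mod_cast hf
      rw [degree_eq_natDegree h0, natDegree_divByMonic f hmon, hdeg]
      have hle : s.card ≤ f.natDegree := by
        by_contra hlt
        apply h0
        rw [divByMonic_eq_zero_iff hmon, hw, Lagrange.degree_nodal, degree_eq_natDegree hf0]
        exact_mod_cast not_le.mp hlt
      norm_cast
      omega
  have hev : ∀ ξ ∈ s, (f %ₘ w).eval ξ = f.eval ξ := by
    intro ξ hξ
    conv_rhs => rw [← modByMonic_add_div f w]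
    have : eval ξ w = 0 := Lagrange.eval_nodal_at_node (v := id) hξ
    simp [this]
  have hint := Lagrange.eq_interpolate (v := id) (Set.injOn_id _) hr
  conv_lhs => rw [← modByMonic_add_div f w]
  rw [map_add, horth _ hq, add_zero, hint, Lagrange.interpolate_apply, map_sum]
  refine Finset.sum_congr rfl fun ξ hξ => ?_
  rw [← smul_eq_C_mul, map_smul, smul_eq_mul, id, hev ξ hξ, mul_comm]
  rfl

/-- A polynomial of degree `#s` vanishing on `s` is a multiple of the nodal polynomial of `s`. -/
lemma eq_leadingCoeff_smul_nodal {p : ℝ[X]} {s : Finset ℝ} (hp : p ≠ 0)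
    (hdeg : p.natDegree = s.card) (hs : ∀ x ∈ s, p.eval x = 0) :
    p = p.leadingCoeff • Lagrange.nodal s id := by
  have hlc : p.leadingCoeff ≠ 0 := leadingCoeff_ne_zero.mpr hp
  have hd : p.degree = s.card := by rw [degree_eq_natDegree hp, hdeg]
  refine eq_of_degree_le_of_eval_finset_eq s hd.le ?_ ?_ ?_
  · rw [degree_smul_of_smul_regular _ (IsSMulRegular.of_ne_zero hlc), Lagrange.degree_nodal, hd]
  · rw [smul_eq_C_mul, leadingCoeff_mul, leadingCoeff_C, Lagrange.nodal_monic.leadingCoeff, mul_one]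
  · intro x hx
    have : eval x (Lagrange.nodal s (id : ℝ → ℝ)) = 0 :=
      Lagrange.eval_nodal_at_node (v := id) hx
    simp [hs x hx, this]

/-- Such a `p` is a nonzero multiple of the nodal polynomial, so orthogonality can be proved for `p`
in closed form and then transferred. -/
lemma unitIntegral_nodal_mul_eq_zero {p : ℝ[X]} {s : Finset ℝ} {m : ℕ} (hp : p ≠ 0)
    (hdeg : p.natDegree = s.card) (hs : ∀ x ∈ s, p.eval x = 0)
    (horth : ∀ q : ℝ[X], q.degree < m → unitIntegral (p * q) = 0) (q : ℝ[X]) (hq : q.degree < m) :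
    unitIntegral (Lagrange.nodal s id * q) = 0 := by
  have h := horth q hq
  rw [eq_leadingCoeff_smul_nodal hp hdeg hs, smul_mul_assoc, map_smul, smul_eq_mul] at h
  exact (mul_eq_zero.mp h).resolve_left (leadingCoeff_ne_zero.mpr hp)

/-! ### Zeros and orthogonality of the Legendre polynomials -/

/-- The theorem of Rolle for the zeros of a polynomial in `[0, 1]`. -/
lemma card_le_card_derivative_roots_Ioo {p : ℝ[X]} (hp : derivative p ≠ 0) {s : Finset ℝ}
    (hs : ∀ x ∈ s, x ∈ Set.Icc (0 : ℝ) 1 ∧ p.eval x = 0) :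
    s.card ≤ ((derivative p).roots.toFinset.filter (· ∈ Set.Ioo (0 : ℝ) 1)).card + 1 := by
  refine Finset.card_le_of_interleaved fun x hx y hy hxy _ => ?_
  obtain ⟨z, hz, hz0⟩ := exists_deriv_eq_zero hxy p.continuousOn ((hs x hx).2.trans (hs y hy).2.symm)
  rw [p.deriv] at hz0
  exact ⟨z, by simp only [Finset.mem_filter, Multiset.mem_toFinset, mem_roots hp, IsRoot]
               exact ⟨hz0, (hs x hx).1.1.trans_lt hz.1, hz.2.trans_le (hs y hy).1.2⟩, hz.1, hz.2⟩

/-- The polynomial `(x (1 - x))ⁿ` of the Rodrigues formula. -/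
def rodrigues (n : ℕ) : ℝ[X] := X ^ n * (1 - X) ^ n

lemma natDegree_one_sub_X : (1 - X : ℝ[X]).natDegree = 1 := by
  rw [← neg_sub, natDegree_neg, ← C_1, natDegree_X_sub_C]

lemma one_sub_X_ne_zero : (1 - X : ℝ[X]) ≠ 0 := by
  intro h
  have := natDegree_one_sub_X
  simp [h] at this

lemma natDegree_rodrigues (n : ℕ) : (rodrigues n).natDegree = 2 * n := by
  rw [rodrigues, natDegree_mul (pow_ne_zero _ X_ne_zero) (pow_ne_zero _ one_sub_X_ne_zero),
    natDegree_X_pow, natDegree_pow, natDegree_one_sub_X]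
  ring

/-- Zero is a root of multiplicity at least `n`, and each derivative lowers this by at most one.
These are the boundary terms in the integrations by parts and the extra points for Rolle. -/
lemma eval_zero_iterate_derivative_rodrigues {n j : ℕ} (hj : j < n) :
    (derivative^[j] (rodrigues n)).eval 0 = 0 := by
  have h : X ^ (n - j) ∣ derivative^[j] (rodrigues n) :=
    pow_sub_dvd_iterate_derivative_of_pow_dvd j (Dvd.intro _ rfl)
  have := (dvd_pow_self X (Nat.sub_ne_zero_of_lt hj)).trans h
  exact eval_eq_zero_of_dvd_of_eval_eq_zero this (by simp)

lemma eval_one_iterate_derivative_rodrigues {n j : ℕ} (hj : j < n) :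
    (derivative^[j] (rodrigues n)).eval 1 = 0 := by
  have h : (1 - X) ^ (n - j) ∣ derivative^[j] (rodrigues n) :=
    pow_sub_dvd_iterate_derivative_of_pow_dvd j (Dvd.intro_left _ rfl)
  have := (dvd_pow_self (1 - X : ℝ[X]) (Nat.sub_ne_zero_of_lt hj)).trans h
  exact eval_eq_zero_of_dvd_of_eval_eq_zero this (by simp)

lemma natDegree_iterate_derivative_eq {p : ℝ[X]} {j : ℕ} :
    (derivative^[j] p).natDegree = p.natDegree - j := by
  induction j with
  | zero => simp
  | succ j ih => rw [Function.iterate_succ_apply', natDegree_derivative, ih]; omega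

lemma iterate_derivative_rodrigues_ne_zero {n j : ℕ} (hj : j ≤ n) :
    derivative^[j] (rodrigues n) ≠ 0 := by
  have h0 : rodrigues n ≠ 0 :=
    mul_ne_zero (pow_ne_zero _ X_ne_zero) (pow_ne_zero _ one_sub_X_ne_zero)
  intro h
  have hd := natDegree_iterate_derivative_eq (p := rodrigues n) (j := j)
  rw [h, natDegree_zero, natDegree_rodrigues] at hd
  -- Degrees give `2 * n - j = 0` in truncated subtraction, which with `j ≤ n` leaves only `n = j =
  -- 0`.
  obtain rfl : j = 0 := by omega
  exact h0 h

/-- Induction by Rolle: `j` zeros inside, together with the end points, which are still zeros while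
`j < n`, make `j + 2` points and hence `j + 1` zeros of the next derivative. -/
lemma le_card_roots_iterate_derivative_rodrigues {n j : ℕ} (hj : j ≤ n) :
    j ≤ ((derivative^[j] (rodrigues n)).roots.toFinset.filter (· ∈ Set.Ioo (0 : ℝ) 1)).card := by
  induction j with
  | zero => simp
  | succ j ih =>
    have ih := ih (by omega)
    set p := derivative^[j] (rodrigues n) with hp
    set R := p.roots.toFinset.filter (· ∈ Set.Ioo (0 : ℝ) 1) with hR
    have hd : derivative p ≠ 0 := by
      rw [hp, ← Function.iterate_succ_apply' derivative]
      exact iterate_derivative_rodrigues_ne_zero hj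
    have h1 : (1 : ℝ) ∉ R := by simp [hR]
    have h0 : (0 : ℝ) ∉ insert 1 R := by simp [hR]
    have key := card_le_card_derivative_roots_Ioo hd (s := insert 0 (insert 1 R)) (by
      intro x hx
      simp only [Finset.mem_insert] at hx
      rcases hx with rfl | rfl | hx
      · exact ⟨by simp, eval_zero_iterate_derivative_rodrigues hj⟩
      · exact ⟨by simp, eval_one_iterate_derivative_rodrigues hj⟩
      · simp only [hR, Finset.mem_filter, Multiset.mem_toFinset] at hx
        exact ⟨Set.Ioo_subset_Icc_self hx.2, isRoot_of_mem_roots hx.1⟩)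
    rw [Finset.card_insert_of_notMem h0, Finset.card_insert_of_notMem h1] at key
    rw [Function.iterate_succ_apply', ← hp]
    omega

/-- The Rodrigues formula, the source of both the zeros and the orthogonality. -/
lemma factorial_smul_legendre (n : ℕ) :
    (n.factorial : ℝ) • legendre n = derivative^[n] (rodrigues n) := by
  have h := congrArg (Polynomial.map (Int.castRingHom ℝ)) (factorial_mul_shiftedLegendre_eq n)
  rw [← iterate_derivative_map] at h
  simpa [legendre, rodrigues, smul_eq_C_mul] using h

lemma natDegree_legendre (n : ℕ) : (legendre n).natDegree = n := by
  rw [legendre, natDegree_map_eq_of_injective (RingHom.injective_int _), natDegree_shiftedLegendre]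

lemma legendre_ne_zero (n : ℕ) : legendre n ≠ 0 := by
  intro h
  have := factorial_smul_legendre n
  rw [h, smul_zero] at this
  exact iterate_derivative_rodrigues_ne_zero le_rfl this.symm

lemma roots_iterate_derivative_rodrigues (n : ℕ) :
    (derivative^[n] (rodrigues n)).roots = (legendre n).roots := by
  rw [← factorial_smul_legendre, roots_smul_nonzero _ (by exact_mod_cast n.factorial_ne_zero)]

lemma le_card_filter_gaussNodes (n : ℕ) :
    n ≤ ((gaussNodes n).filter (· ∈ Set.Ioo (0 : ℝ) 1)).card := by
  have h := le_card_roots_iterate_derivative_rodrigues (le_refl n)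
  rwa [roots_iterate_derivative_rodrigues] at h

/-- Rolle gives at least `n` zeros in the open interval and the degree allows no more; the same
count puts all of them there. -/
lemma card_gaussNodes (n : ℕ) : (gaussNodes n).card = n := by
  refine le_antisymm ?_ ((le_card_filter_gaussNodes n).trans (Finset.card_filter_le _ _))
  refine (Multiset.toFinset_card_le _).trans ((card_roots' _).trans (natDegree_legendre n).le)

lemma gaussNodes_subset_Ioo {n : ℕ} {x : ℝ} (hx : x ∈ gaussNodes n) : x ∈ Set.Ioo (0 : ℝ) 1 := by
  have h := Finset.eq_of_subset_of_card_le
    (Finset.filter_subset (· ∈ Set.Ioo (0 : ℝ) 1) (gaussNodes n))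
    ((card_gaussNodes n).le.trans (le_card_filter_gaussNodes n))
  rw [← h] at hx
  exact (Finset.mem_filter.mp hx).2

lemma eval_legendre_eq_zero {n : ℕ} {x : ℝ} (hx : x ∈ gaussNodes n) : (legendre n).eval x = 0 :=
  isRoot_of_mem_roots (Multiset.mem_toFinset.mp hx)

/-- Each integration by parts moves one derivative onto `q` without boundary terms, until `q` is
differentiated away. -/
lemma unitIntegral_iterate_derivative_rodrigues_mul {n m : ℕ} (hm : m ≤ n) (q : ℝ[X])
    (hq : q.degree < m) : unitIntegral (derivative^[m] (rodrigues n) * q) = 0 := by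
  induction m generalizing q with
  | zero =>
    have : q = 0 := by simpa using hq
    simp [this]
  | succ m ih =>
    rw [Function.iterate_succ_apply', unitIntegral_derivative_mul,
      eval_zero_iterate_derivative_rodrigues hm, eval_one_iterate_derivative_rodrigues hm,
      ih (by omega)]
    · simp
    · rcases eq_or_ne q 0 with rfl | h0
      · simp
      · have h1 := degree_derivative_lt h0
        have h2 : q.degree ≤ m := by
          rw [degree_eq_natDegree h0] at hq ⊢
          exact_mod_cast Nat.lt_succ_iff.mp (by exact_mod_cast hq)
        exact h1.trans_le h2

/-- The Legendre polynomial of degree `n` is orthogonal to all polynomials of lower degree. -/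
theorem unitIntegral_legendre_mul {n : ℕ} (q : ℝ[X]) (hq : q.degree < n) :
    unitIntegral (legendre n * q) = 0 := by
  have h := unitIntegral_iterate_derivative_rodrigues_mul le_rfl q hq
  rw [← factorial_smul_legendre, smul_mul_assoc, map_smul, smul_eq_mul] at h
  exact (mul_eq_zero.mp h).resolve_left (by exact_mod_cast n.factorial_ne_zero)

/-! ### The Gauss rule -/

theorem unitIntegral_eq_gauss_sum {n : ℕ} (f : ℝ[X]) (hf : f.degree < (2 * n : ℕ)) :
    unitIntegral f = ∑ ξ ∈ gaussNodes n, quadWeight (gaussNodes n) ξ * f.eval ξ := by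
  refine unitIntegral_eq_sum_quadWeight _ n ?_ f (by rwa [card_gaussNodes, ← two_mul])
  exact unitIntegral_nodal_mul_eq_zero (legendre_ne_zero n)
    (by rw [natDegree_legendre, card_gaussNodes]) (fun x hx => eval_legendre_eq_zero hx)
    unitIntegral_legendre_mul

/-- The rule integrates the square of the Lagrange basis polynomial exactly (degree `2n - 2`), and
only the node `ξ` contributes: the weight is the integral of a square. -/
lemma quadWeight_gaussNodes_pos {n : ℕ} {ξ : ℝ} (hξ : ξ ∈ gaussNodes n) :
    0 < quadWeight (gaussNodes n) ξ := by
  set ℓ := Lagrange.basis (gaussNodes n) id ξ with hℓ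
  have hinj : Set.InjOn (id : ℝ → ℝ) (gaussNodes n) := Set.injOn_id _
  have hself : ℓ.eval ξ = 1 := Lagrange.eval_basis_self (v := id) hinj hξ
  have hn : 0 < n := by
    rw [← card_gaussNodes n]; exact Finset.card_pos.mpr ⟨ξ, hξ⟩
  have hdeg : (ℓ ^ 2).degree < (2 * n : ℕ) := by
    have h0 : ℓ ≠ 0 := Lagrange.basis_ne_zero hinj hξ
    rw [degree_eq_natDegree (pow_ne_zero _ h0), natDegree_pow, hℓ,
      Lagrange.natDegree_basis hinj hξ, card_gaussNodes]
    norm_cast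
    omega
  have hsum := unitIntegral_eq_gauss_sum (ℓ ^ 2) hdeg
  rw [Finset.sum_eq_single_of_mem ξ hξ] at hsum
  · simp only [eval_pow, hself, one_pow, mul_one] at hsum
    rw [← hsum, unitIntegral_apply]
    refine intervalIntegral.integral_pos zero_lt_one (ℓ ^ 2).continuous.continuousOn ?_ ?_
    · intro x _; rw [eval_pow]; positivity
    · exact ⟨ξ, Set.Ioo_subset_Icc_self (gaussNodes_subset_Ioo hξ), by simp [hself]⟩
  · intro η hη hne
    have : ℓ.eval η = 0 := Lagrange.eval_basis_of_ne (v := id) hne.symm hη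
    simp [this]

/-! ### The Gauss–Lobatto rule -/

lemma derivative_legendre_ne_zero {n : ℕ} (hn : 1 ≤ n) : derivative (legendre n) ≠ 0 := by
  intro h
  rw [derivative_eq_zero, natDegree_legendre] at h
  omega

lemma le_card_filter_roots_derivative_legendre {n : ℕ} (hn : 1 ≤ n) :
    n - 1 ≤ ((derivative (legendre n)).roots.toFinset.filter (· ∈ Set.Ioo (0 : ℝ) 1)).card := by
  have h := card_le_card_derivative_roots_Ioo (derivative_legendre_ne_zero hn) (s := gaussNodes n)
    fun x hx => ⟨Set.Ioo_subset_Icc_self (gaussNodes_subset_Ioo hx), eval_legendre_eq_zero hx⟩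
  rw [card_gaussNodes] at h
  omega

lemma card_roots_derivative_legendre {n : ℕ} (hn : 1 ≤ n) :
    (derivative (legendre n)).roots.toFinset.card = n - 1 := by
  refine le_antisymm ?_
    ((le_card_filter_roots_derivative_legendre hn).trans (Finset.card_filter_le _ _))
  refine (Multiset.toFinset_card_le _).trans ((card_roots' _).trans ?_)
  rw [natDegree_derivative, natDegree_legendre]

lemma mem_Ioo_of_mem_roots_derivative_legendre {n : ℕ} (hn : 1 ≤ n) {x : ℝ}
    (hx : x ∈ (derivative (legendre n)).roots.toFinset) : x ∈ Set.Ioo (0 : ℝ) 1 := by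
  have h := Finset.eq_of_subset_of_card_le
    (Finset.filter_subset (· ∈ Set.Ioo (0 : ℝ) 1) (derivative (legendre n)).roots.toFinset)
    ((card_roots_derivative_legendre hn).le.trans (le_card_filter_roots_derivative_legendre hn))
  rw [← h] at hx
  exact (Finset.mem_filter.mp hx).2

lemma mem_lobattoNodes {L : ℕ} {x : ℝ} : x ∈ lobattoNodes L ↔
    x = 0 ∨ x = 1 ∨ x ∈ (derivative (legendre (L - 1))).roots.toFinset := by
  simp only [lobattoNodes, Finset.mem_union, Finset.mem_insert, Finset.mem_singleton, or_assoc]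

lemma card_lobattoNodes {L : ℕ} (hL : 2 ≤ L) : (lobattoNodes L).card = L := by
  rw [lobattoNodes, Finset.card_union_of_disjoint, card_roots_derivative_legendre (by omega),
    Finset.card_pair zero_ne_one]
  · omega
  · rw [Finset.disjoint_left]
    intro x hx hx'
    have := mem_Ioo_of_mem_roots_derivative_legendre (by omega) hx'
    simp only [Finset.mem_insert, Finset.mem_singleton] at hx
    rcases hx with rfl | rfl
    · simp at this
    · simp at this

lemma natDegree_X_mul_one_sub_X : (X * (1 - X) : ℝ[X]).natDegree = 2 := by
  rw [natDegree_mul X_ne_zero one_sub_X_ne_zero, natDegree_X, natDegree_one_sub_X]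

/-- `x (1 - x) (d/dx) Pₙ(x)` is orthogonal to all polynomials of degree at most `n - 2`. -/
lemma unitIntegral_derivative_legendre_mul {n : ℕ} (q : ℝ[X]) (hq : q.degree < (n - 1 : ℕ)) :
    unitIntegral (X * (1 - X) * derivative (legendre n) * q) = 0 := by
  -- Integration by parts has no boundary terms because of the factor `X * (1 - X)`. What is left
  -- pairs the Legendre polynomial with the derivative of `X * (1 - X) * q`, of degree below `n`.
  rw [show X * (1 - X) * derivative (legendre n) * q
    = derivative (legendre n) * (X * (1 - X) * q) by ring, unitIntegral_derivative_mul,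
    unitIntegral_legendre_mul]
  · simp
  · rcases eq_or_ne q 0 with rfl | h0
    · simp
    · have hne : X * (1 - X) * q ≠ 0 := mul_ne_zero (mul_ne_zero X_ne_zero one_sub_X_ne_zero) h0
      rw [degree_eq_natDegree h0] at hq
      have hq' : q.natDegree < n - 1 := by exact_mod_cast hq
      refine (degree_derivative_lt hne).trans_le ?_
      rw [degree_eq_natDegree hne, natDegree_mul (mul_ne_zero X_ne_zero one_sub_X_ne_zero) h0,
        natDegree_X_mul_one_sub_X]
      norm_cast
      omega

/-- The nodal polynomial is proportional to `x (1 - x) P'_{L-1}(x)`, orthogonal to degrees below `L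
- 2`, so exactness holds below `L + (L - 2)`. -/
theorem unitIntegral_eq_lobatto_sum {L : ℕ} (hL : 2 ≤ L) (f : ℝ[X])
    (hf : f.degree < (2 * L - 2 : ℕ)) :
    unitIntegral f = ∑ ξ ∈ lobattoNodes L, quadWeight (lobattoNodes L) ξ * f.eval ξ := by
  have hd := derivative_legendre_ne_zero (n := L - 1) (by omega)
  have h2 : (X * (1 - X) : ℝ[X]) ≠ 0 := mul_ne_zero X_ne_zero one_sub_X_ne_zero
  refine unitIntegral_eq_sum_quadWeight _ (L - 2) ?_ f (by
    rwa [card_lobattoNodes hL, show L + (L - 2) = 2 * L - 2 by omega])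
  refine unitIntegral_nodal_mul_eq_zero (p := X * (1 - X) * derivative (legendre (L - 1)))
    (mul_ne_zero h2 hd) ?_ ?_ fun q hq => unitIntegral_derivative_legendre_mul q hq
  · rw [natDegree_mul h2 hd, natDegree_X_mul_one_sub_X, natDegree_derivative, natDegree_legendre,
      card_lobattoNodes hL]
    omega
  · intro x hx
    rcases mem_lobattoNodes.mp hx with rfl | rfl | h
    · simp
    · simp
    · have : (derivative (legendre (L - 1))).eval x = 0 :=
        isRoot_of_mem_roots (Multiset.mem_toFinset.mp h)
      simp [this]

/-- Test the rule on `x (1 - x) ℓ(x)²`, with `ℓ` the Lagrange basis polynomial over the interior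
nodes only. It has degree `2L - 4`, is nonnegative on the interval, and vanishes at every node but
`ξ`. -/
lemma quadWeight_lobattoNodes_nonneg {L : ℕ} (hL : 2 ≤ L) {ξ : ℝ} (hξ : ξ ∈ lobattoNodes L)
    (h0 : ξ ≠ 0) (h1 : ξ ≠ 1) : 0 ≤ quadWeight (lobattoNodes L) ξ := by
  set R := (derivative (legendre (L - 1))).roots.toFinset with hR
  have hξR : ξ ∈ R := ((mem_lobattoNodes.mp hξ).resolve_left h0).resolve_left h1
  have hξI := mem_Ioo_of_mem_roots_derivative_legendre (n := L - 1) (by omega) hξR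
  set ℓ := Lagrange.basis R id ξ with hℓ
  have hinj : Set.InjOn (id : ℝ → ℝ) R := Set.injOn_id _
  have hself : ℓ.eval ξ = 1 := Lagrange.eval_basis_self (v := id) hinj hξR
  have hℓ0 : ℓ ≠ 0 := Lagrange.basis_ne_zero hinj hξR
  have h2 : (X * (1 - X) : ℝ[X]) ≠ 0 := mul_ne_zero X_ne_zero one_sub_X_ne_zero
  have hcard : R.card = L - 1 - 1 := card_roots_derivative_legendre (by omega)
  have hpos : 0 < R.card := Finset.card_pos.mpr ⟨ξ, hξR⟩
  have hdeg : (X * (1 - X) * ℓ ^ 2 : ℝ[X]).degree < (2 * L - 2 : ℕ) := by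
    rw [degree_eq_natDegree (mul_ne_zero h2 (pow_ne_zero _ hℓ0)),
      natDegree_mul h2 (pow_ne_zero _ hℓ0), natDegree_X_mul_one_sub_X, natDegree_pow, hℓ,
      Lagrange.natDegree_basis hinj hξR]
    norm_cast
    omega
  have hsum := unitIntegral_eq_lobatto_sum hL _ hdeg
  rw [Finset.sum_eq_single_of_mem ξ hξ] at hsum
  · have hge : 0 ≤ unitIntegral (X * (1 - X) * ℓ ^ 2) := by
      refine unitIntegral_nonneg fun t ht => ?_
      simp only [eval_mul, eval_X, eval_sub, eval_one, eval_pow]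
      exact mul_nonneg (mul_nonneg ht.1 (sub_nonneg.mpr ht.2)) (sq_nonneg _)
    simp only [eval_mul, eval_X, eval_sub, eval_one, eval_pow, hself, one_pow, mul_one] at hsum
    rw [hsum] at hge
    exact nonneg_of_mul_nonneg_left hge (mul_pos hξI.1 (sub_pos.mpr hξI.2))
  · intro η hη hne
    rcases mem_lobattoNodes.mp hη with rfl | rfl | h
    · simp
    · simp
    · have : ℓ.eval η = 0 := Lagrange.eval_basis_of_ne (v := id) hne.symm h
      simp [this]

lemma legendre_comp_one_sub_X (n : ℕ) : (legendre n).comp (1 - X) = (-1) ^ n * legendre n := by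
  have h := congrArg (Polynomial.map (Int.castRingHom ℝ))
    (neg_one_pow_mul_shiftedLegendre_comp_one_sub_X_eq n)
  simp only [Polynomial.map_mul, Polynomial.map_pow, Polynomial.map_neg, Polynomial.map_one,
    Polynomial.map_comp, Polynomial.map_sub, Polynomial.map_X] at h
  change (-1) ^ n * (legendre n).comp (1 - X) = legendre n at h
  rw [← h, ← mul_assoc, ← mul_pow]
  simp [h]

lemma one_sub_mem_lobattoNodes {L : ℕ} (hL : 2 ≤ L) {ξ : ℝ} (hξ : ξ ∈ lobattoNodes L) :
    1 - ξ ∈ lobattoNodes L := by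
  rw [mem_lobattoNodes] at hξ ⊢
  rcases hξ with rfl | rfl | h
  · simp
  · simp
  · right; right
    have hd := derivative_legendre_ne_zero (n := L - 1) (by omega)
    simp only [Multiset.mem_toFinset, mem_roots hd, IsRoot] at h ⊢
    have hc := congrArg (fun p => (derivative p).eval ξ) (legendre_comp_one_sub_X (L - 1))
    rw [show ((-1 : ℝ[X]) ^ (L - 1)) = C ((-1) ^ (L - 1)) by simp] at hc
    simp only [derivative_comp, derivative_C_mul, eval_mul, eval_comp, h, mul_zero] at hc
    simpa using hc

/-- The nodes are symmetric under `x ↦ 1 - x`. Hence the reflected basis polynomial of the node `0`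
vanishes at all nodes but `1`, and it has the same integral. -/
lemma quadWeight_lobattoNodes_one {L : ℕ} (hL : 2 ≤ L) :
    quadWeight (lobattoNodes L) 1 = quadWeight (lobattoNodes L) 0 := by
  have m0 : (0 : ℝ) ∈ lobattoNodes L := mem_lobattoNodes.mpr (Or.inl rfl)
  have m1 : (1 : ℝ) ∈ lobattoNodes L := mem_lobattoNodes.mpr (Or.inr (Or.inl rfl))
  have hinj : Set.InjOn (id : ℝ → ℝ) (lobattoNodes L) := Set.injOn_id _
  set ℓ := Lagrange.basis (lobattoNodes L) id 0 with hℓ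
  have hself : ℓ.eval 0 = 1 := Lagrange.eval_basis_self (v := id) hinj m0
  have hdeg : (ℓ.comp (1 - X)).degree < (2 * L - 2 : ℕ) := by
    refine degree_le_natDegree.trans_lt ?_
    rw [natDegree_comp, natDegree_one_sub_X, hℓ, Lagrange.natDegree_basis hinj m0,
      card_lobattoNodes hL]
    norm_cast
    omega
  have hsum := unitIntegral_eq_lobatto_sum hL _ hdeg
  rw [Finset.sum_eq_single_of_mem 1 m1] at hsum
  · simp only [eval_comp, eval_sub, eval_one, eval_X, sub_self, hself, mul_one] at hsum
    rw [← hsum, unitIntegral_apply, quadWeight]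
    simp only [eval_comp, eval_sub, eval_one, eval_X]
    rw [intervalIntegral.integral_comp_sub_left (fun x => ℓ.eval x) 1]
    simp [hℓ]
  · intro η hη hne
    have : ℓ.eval (1 - η) = 0 :=
      Lagrange.eval_basis_of_ne (v := id) (sub_ne_zero.mpr hne.symm).symm
        (one_sub_mem_lobattoNodes hL hη)
    simp [this]

/-! ### The rules used with polynomial degree `k` -/

lemma gaussWeight_pos {k : ℕ} {μ : ℝ} (hμ : μ ∈ gauss k) : 0 < gaussWeight k μ :=
  quadWeight_gaussNodes_pos hμ

lemma gauss_nonempty (k : ℕ) : (gauss k).Nonempty := by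
  rw [← Finset.card_pos, gauss, card_gaussNodes]
  omega

lemma unitIntegral_eq_gaussWeight_sum {k : ℕ} {f : ℝ[X]} (hf : f.natDegree ≤ k) :
    unitIntegral f = ∑ μ ∈ gauss k, gaussWeight k μ * f.eval μ := by
  refine unitIntegral_eq_gauss_sum f (degree_le_natDegree.trans_lt ?_)
  norm_cast
  omega

lemma sum_gaussWeight (k : ℕ) : ∑ μ ∈ gauss k, gaussWeight k μ = 1 := by
  have h := unitIntegral_eq_gaussWeight_sum (k := k) (f := 1) (by simp)
  simpa [unitIntegral_one] using h.symm

lemma two_le_lobatto_order (k : ℕ) : 2 ≤ (k + 3) ⌈/⌉ 2 := by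
  rw [Nat.ceilDiv_eq_add_pred_div]; omega

lemma unitIntegral_eq_lobattoWeight_sum {k : ℕ} {f : ℝ[X]} (hf : f.natDegree ≤ k) :
    unitIntegral f = ∑ ν ∈ lobatto k, quadWeight (lobatto k) ν * f.eval ν := by
  refine unitIntegral_eq_lobatto_sum (two_le_lobatto_order k) f (degree_le_natDegree.trans_lt ?_)
  norm_cast
  -- The choice of `L` is what gives `k < 2L - 2`.
  rw [Nat.ceilDiv_eq_add_pred_div]
  omega

lemma zero_mem_lobatto (k : ℕ) : (0 : ℝ) ∈ lobatto k := mem_lobattoNodes.mpr (Or.inl rfl)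

lemma one_mem_lobatto (k : ℕ) : (1 : ℝ) ∈ lobatto k := mem_lobattoNodes.mpr (Or.inr (Or.inl rfl))

lemma lobattoWeight_one (k : ℕ) : quadWeight (lobatto k) 1 = lobattoWeight₁ k :=
  quadWeight_lobattoNodes_one (two_le_lobatto_order k)

lemma lobattoWeight_nonneg {k : ℕ} {ν : ℝ} (hν : ν ∈ lobatto k) (h0 : ν ≠ 0) (h1 : ν ≠ 1) :
    0 ≤ quadWeight (lobatto k) ν :=
  quadWeight_lobattoNodes_nonneg (two_le_lobatto_order k) hν h0 h1

end CDG

end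

/-! ### The splitting inequality for pairs of admissible MHD states. -/

noncomputable section

namespace CDG

/-! ### Algebra of `ℝ³` -/

lemma dotProduct_three (a b : Fin 3 → ℝ) : a ⬝ᵥ b = a 0 * b 0 + a 1 * b 1 + a 2 * b 2 := by
  simp [dotProduct, Fin.sum_univ_three]

lemma normSq_three (a : Fin 3 → ℝ) : normSq a = a 0 ^ 2 + a 1 ^ 2 + a 2 ^ 2 := by
  rw [normSq, dotProduct_three]; ring

lemma normSq_nonneg (a : Fin 3 → ℝ) : 0 ≤ normSq a := by
  rw [normSq_three]; positivity

lemma sq_apply_le_normSq (a : Fin 3 → ℝ) (i : Fin 3) : a i ^ 2 ≤ normSq a := by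
  rw [normSq_three]
  fin_cases i <;> simp <;> nlinarith [sq_nonneg (a 0), sq_nonneg (a 1), sq_nonneg (a 2)]

lemma dotProduct_sq_le (a b : Fin 3 → ℝ) : (a ⬝ᵥ b) ^ 2 ≤ normSq a * normSq b := by
  rw [dotProduct_three, normSq_three, normSq_three]
  nlinarith [sq_nonneg (a 0 * b 1 - a 1 * b 0), sq_nonneg (a 0 * b 2 - a 2 * b 0),
    sq_nonneg (a 1 * b 2 - a 2 * b 1)]

/-! ### The wave speeds -/

/-- The defining quadratic equation of the fast speed, of which it is the larger root. -/
lemma fastSpeed_sq_spec {eos : ℝ → ℝ → ℝ} {i : Fin 3} {U : State} (hρ : 0 < density U) :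
    normSq (magnetic U) / density U + soundSpeed eos U ^ 2 ≤ 2 * fastSpeed eos i U ^ 2 ∧
    (2 * fastSpeed eos i U ^ 2 - (normSq (magnetic U) / density U + soundSpeed eos U ^ 2)) ^ 2
      = (normSq (magnetic U) / density U + soundSpeed eos U ^ 2) ^ 2
        - 4 * (magnetic U i ^ 2 * soundSpeed eos U ^ 2 / density U) := by
  set c := soundSpeed eos U
  set ρ := density U
  set T := normSq (magnetic U) / ρ + c ^ 2 with hT
  set Δ := T ^ 2 - 4 * (magnetic U i ^ 2 * c ^ 2 / ρ) with hΔ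
  have hTi : magnetic U i ^ 2 / ρ + c ^ 2 ≤ T := by
    have := sq_apply_le_normSq (magnetic U) i
    rw [hT]; gcongr
  have hTi0 : 0 ≤ magnetic U i ^ 2 / ρ := by positivity
  have hT0 : 0 ≤ T := by nlinarith [sq_nonneg c]
  -- Since `T ≥ B_i²/ρ + c²`, the discriminant is at least `(B_i²/ρ - c²)²`.
  have hΔ0 : 0 ≤ Δ := by
    have h : magnetic U i ^ 2 * c ^ 2 / ρ = magnetic U i ^ 2 / ρ * c ^ 2 := by ring
    rw [hΔ, h]
    nlinarith [sq_nonneg (magnetic U i ^ 2 / ρ - c ^ 2), sq_nonneg c]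
  have hC : fastSpeed eos i U ^ 2 = (T + √Δ) / 2 := by
    have h2 : (1 / √2 : ℝ) ^ 2 = 1 / 2 := by rw [div_pow, Real.sq_sqrt (by norm_num)]; norm_num
    have : fastSpeed eos i U = 1 / √2 * √(T + √Δ) := rfl
    rw [this, mul_pow, h2, Real.sq_sqrt (by positivity)]
    ring
  constructor
  · rw [hC]; linarith [Real.sqrt_nonneg Δ]
  · rw [hC, show 2 * ((T + √Δ) / 2) - T = √Δ by ring, Real.sq_sqrt hΔ0]

lemma fastSpeed_nonneg (eos : ℝ → ℝ → ℝ) (i : Fin 3) (U : State) : 0 ≤ fastSpeed eos i U := by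
  unfold fastSpeed; positivity

lemma specificEnergy_pos {U : State} (hU : U ∈ admissible) : 0 < specificEnergy U :=
  div_pos hU.2 hU.1

lemma soundSpeed_pos {eos : ℝ → ℝ → ℝ} (heos : ∀ ρ e : ℝ, 0 < ρ → (0 < eos ρ e ↔ 0 < e))
    {U : State} (hU : U ∈ admissible) : 0 < soundSpeed eos U := by
  have he := specificEnergy_pos hU
  have hp : 0 < pressure eos U := (heos _ _ hU.1).mpr he
  have hρ := hU.1
  unfold soundSpeed
  positivity

lemma fastSpeed_pos {eos : ℝ → ℝ → ℝ} (heos : ∀ ρ e : ℝ, 0 < ρ → (0 < eos ρ e ↔ 0 < e))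
    {U : State} (hU : U ∈ admissible) (i : Fin 3) : 0 < fastSpeed eos i U := by
  have hc := soundSpeed_pos heos hU
  have h := (fastSpeed_sq_spec (eos := eos) (i := i) hU.1).1
  have h0 : 0 ≤ normSq (magnetic U) / density U := div_nonneg (normSq_nonneg _) hU.1.le
  have : 0 < fastSpeed eos i U ^ 2 := by nlinarith
  exact (fastSpeed_nonneg eos i U).lt_of_ne fun h => by rw [← h] at this; simp at this

lemma pressure_eq {eos : ℝ → ℝ → ℝ} {U : State} (hU : U ∈ admissible) :
    pressure eos U = soundSpeed eos U * density U * √(2 * specificEnergy U) := by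
  have he := specificEnergy_pos hU
  have hρ := hU.1
  have : √(2 * specificEnergy U) ≠ 0 := by positivity
  unfold soundSpeed
  field_simp

/-! ### The spectral estimate behind the fast speed -/

/-- Spectral bound, with the distinguished direction listed first; `l` is the larger root of
`l² - (|B|²/ρ + c²) l + c² B₁²/ρ`. -/
lemma spectral_bound {ρ c l B₁ B₂ B₃ : ℝ} (hρ : 0 < ρ)
    (h1 : (B₁ ^ 2 + B₂ ^ 2 + B₃ ^ 2) / ρ + c ^ 2 ≤ 2 * l)
    (h2 : (2 * l - ((B₁ ^ 2 + B₂ ^ 2 + B₃ ^ 2) / ρ + c ^ 2)) ^ 2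
      = ((B₁ ^ 2 + B₂ ^ 2 + B₃ ^ 2) / ρ + c ^ 2) ^ 2 - 4 * (B₁ ^ 2 * c ^ 2 / ρ))
    (w₁ w₂ w₃ : ℝ) :
    ρ * c ^ 2 * w₁ ^ 2 + (B₂ * w₁ - B₁ * w₂) ^ 2 + (B₃ * w₁ - B₁ * w₃) ^ 2
      ≤ l * (ρ * (w₁ ^ 2 + w₂ ^ 2 + w₃ ^ 2)) := by
  -- Right side minus left side is the quadratic form `s w₁² + t (w₂² + w₃²) + 2 B₁ w₁ (B₂ w₂ + B₃
  -- w₃)`. The equation for `l` says `s t = B₁² (B₂² + B₃²)`, the borderline case of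
  -- semidefiniteness; the root being the larger one gives `s + t ≥ 0`.
  set s := ρ * l - (B₂ ^ 2 + B₃ ^ 2) - ρ * c ^ 2 with hs
  set t := ρ * l - B₁ ^ 2 with ht
  have hsum : 0 ≤ s + t := by
    have : (B₁ ^ 2 + B₂ ^ 2 + B₃ ^ 2) / ρ * ρ = B₁ ^ 2 + B₂ ^ 2 + B₃ ^ 2 := by field_simp
    nlinarith
  have hst : s * t = B₁ ^ 2 * (B₂ ^ 2 + B₃ ^ 2) := by
    field_simp at h2
    rw [hs, ht]
    nlinarith
  have hst0 : 0 ≤ s * t := by rw [hst]; positivity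
  have hs0 : 0 ≤ s := by
    by_contra h
    have : t ≤ 0 := by nlinarith
    linarith
  have ht0 : 0 ≤ t := by
    by_contra h
    have : s ≤ 0 := by nlinarith
    linarith
  have hβ : (B₂ * w₂ + B₃ * w₃) ^ 2 ≤ (B₂ ^ 2 + B₃ ^ 2) * (w₂ ^ 2 + w₃ ^ 2) := by
    nlinarith [sq_nonneg (B₂ * w₃ - B₃ * w₂)]
  have hn : 0 ≤ s * w₁ ^ 2 + t * (w₂ ^ 2 + w₃ ^ 2) := by positivity
  have key : |2 * B₁ * w₁ * (B₂ * w₂ + B₃ * w₃)| ≤ s * w₁ ^ 2 + t * (w₂ ^ 2 + w₃ ^ 2) := by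
    refine abs_le_of_sq_le_sq ?_ hn
    have e1 : (2 * B₁ * w₁ * (B₂ * w₂ + B₃ * w₃)) ^ 2
        ≤ 4 * (B₁ ^ 2 * w₁ ^ 2) * ((B₂ ^ 2 + B₃ ^ 2) * (w₂ ^ 2 + w₃ ^ 2)) := by
      have : 0 ≤ 4 * (B₁ ^ 2 * w₁ ^ 2) := by positivity
      nlinarith
    have e2 : 4 * (B₁ ^ 2 * w₁ ^ 2) * ((B₂ ^ 2 + B₃ ^ 2) * (w₂ ^ 2 + w₃ ^ 2))
        = 4 * (s * w₁ ^ 2) * (t * (w₂ ^ 2 + w₃ ^ 2)) := by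
      linear_combination (-4 * w₁ ^ 2 * (w₂ ^ 2 + w₃ ^ 2)) * hst
    nlinarith [sq_nonneg (s * w₁ ^ 2 - t * (w₂ ^ 2 + w₃ ^ 2))]
  have := (abs_le.mp key).1
  rw [hs, ht] at this
  nlinarith

lemma spectral_bound_normSq {eos : ℝ → ℝ → ℝ} {U : State} (hρ : 0 < density U) (i : Fin 3)
    (w : Fin 3 → ℝ) :
    density U * soundSpeed eos U ^ 2 * w i ^ 2
        + normSq (fun c => magnetic U c * w i - magnetic U i * w c)
      ≤ fastSpeed eos i U ^ 2 * (density U * normSq w) := by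
  obtain ⟨h1, h2⟩ := fastSpeed_sq_spec (eos := eos) (i := i) hρ
  rw [normSq_three] at h1 h2
  rw [normSq_three, normSq_three]
  fin_cases i
  · simp only [Fin.zero_eta] at h1 h2 ⊢
    have := spectral_bound (B₁ := magnetic U 0) (B₂ := magnetic U 1) (B₃ := magnetic U 2) hρ
      h1 h2 (w 0) (w 1) (w 2)
    linarith
  · have := spectral_bound (B₁ := magnetic U 1) (B₂ := magnetic U 0) (B₃ := magnetic U 2) hρ
      (by simp only [Fin.mk_one] at h1; convert h1 using 3; ring)
      (by simp only [Fin.mk_one] at h2; convert h2 using 5 <;> ring) (w 1) (w 0) (w 2)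
    simp only [Fin.mk_one]
    linarith
  · have := spectral_bound (B₁ := magnetic U 2) (B₂ := magnetic U 0) (B₃ := magnetic U 1) hρ
      (by simp only [Fin.reduceFinMk] at h1; convert h1 using 3; ring)
      (by simp only [Fin.reduceFinMk] at h2; convert h2 using 5 <;> ring) (w 2) (w 0) (w 1)
    simp only [Fin.reduceFinMk]
    linarith

/-! ### The flux in terms of `n*` -/

/-- The part `ρ |v - v*|² / 2 + ρ e` of `U · n* + |B*|² / 2`. -/
def relEnergy (U : State) (v : Fin 3 → ℝ) : ℝ :=
  density U * normSq (velocity U - v) / 2 + internalEnergy U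

/-- The coupling terms of `F_i(U) · n*` that are controlled by the fast speed. -/
def coupling (eos : ℝ → ℝ → ℝ) (i : Fin 3) (U : State) (v B : Fin 3 → ℝ) : ℝ :=
  pressure eos U * (velocity U - v) i
    + (fun c => magnetic U c * (velocity U - v) i - magnetic U i * (velocity U - v) c)
        ⬝ᵥ (magnetic U - B)

lemma dotProduct_eight (a b : State) : a ⬝ᵥ b = a 0 * b 0 + a 1 * b 1 + a 2 * b 2 + a 3 * b 3
    + a 4 * b 4 + a 5 * b 5 + a 6 * b 6 + a 7 * b 7 := by
  simp [dotProduct, Fin.sum_univ_eight]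

/-- Completing the squares in `v - v*` and `B - B*`; this is why the shift is `|B*|²/2`. -/
lemma dotProduct_nStar (U : State) (hρ : density U ≠ 0) (v B : Fin 3 → ℝ) :
    U ⬝ᵥ nStar v B + normSq B / 2 = relEnergy U v + normSq (magnetic U - B) / 2 := by
  have h0 : U 0 ≠ 0 := hρ
  rw [dotProduct_eight]
  simp only [relEnergy, internalEnergy, normSq_three, nStar, velocity, momentum, magnetic, density,
    energy, Pi.sub_apply, Matrix.cons_val]
  field_simp
  ring

/-- Subtracting `(v*·B*) B_i` leaves only quantities relative to `v*` and `B*`, apart from `v*_i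
|B*|²/2`, which does not depend on the state and cancels in flux differences. -/
lemma flux_dotProduct_nStar (eos : ℝ → ℝ → ℝ) (i : Fin 3) (U : State) (hρ : density U ≠ 0)
    (v B : Fin 3 → ℝ) :
    flux eos i U ⬝ᵥ nStar v B - (v ⬝ᵥ B) * magnetic U i
      = velocity U i * relEnergy U v + v i * (normSq (magnetic U - B) / 2)
        + coupling eos i U v B - v i * normSq B / 2 := by
  have h0 : U 0 ≠ 0 := hρ
  rw [dotProduct_eight]
  have m0 : U 1 = U 0 * velocity U 0 := by simp [velocity, momentum, density]; field_simp
  have m1 : U 2 = U 0 * velocity U 1 := by simp [velocity, momentum, density]; field_simp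
  have m2 : U 3 = U 0 * velocity U 2 := by simp [velocity, momentum, density]; field_simp
  have hm : ∀ c, momentum U c = U 0 * velocity U c := by
    intro c; fin_cases c <;> simp [momentum, m0, m1, m2]
  have hE : internalEnergy U
      = energy U - U 0 * normSq (velocity U) / 2 - normSq (magnetic U) / 2 := by
    simp only [internalEnergy, normSq_three, hm, density]
    field_simp
  simp only [relEnergy, hE, coupling, flux, momentumFlux, magneticFlux, energyFlux, normSq_three,
    dotProduct_three, nStar, Pi.sub_apply, Matrix.cons_val, hm, density]
  fin_cases i <;> simp <;> ring

lemma relEnergy_pos {U : State} (hU : U ∈ admissible) (v : Fin 3 → ℝ) : 0 < relEnergy U v := by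
  have h1 := normSq_nonneg (velocity U - v)
  have h2 := hU.1
  have h3 := hU.2
  unfold relEnergy
  positivity

/-- The coupling pairs `(√(2ρe), B - B*)` with `(√ρ 𝓒ₛ w_i, g)`, where `w = v - v*` and `g_c = B_c
w_i - B_i w_c`. Cauchy–Schwarz separates them, the spectral bound estimates the second by `𝓒_i √ρ
|w|`, and the arithmetic-geometric mean inequality yields exactly the relative energy. -/
lemma abs_coupling_le {eos : ℝ → ℝ → ℝ} {U : State} (hU : U ∈ admissible) (i : Fin 3)
    (v B : Fin 3 → ℝ) :
    |coupling eos i U v B|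
      ≤ fastSpeed eos i U * (relEnergy U v + normSq (magnetic U - B) / 2) := by
  set w := velocity U - v with hw
  set b := magnetic U - B with hb
  set g : Fin 3 → ℝ := fun c => magnetic U c * w i - magnetic U i * w c with hg
  set s := √(2 * specificEnergy U) with hs
  set C := fastSpeed eos i U with hC
  have hρ : 0 < density U := hU.1
  have hs2 : density U * s ^ 2 = 2 * internalEnergy U := by
    rw [hs, Real.sq_sqrt (by linarith [specificEnergy_pos hU]), specificEnergy]
    field_simp
  have hspec : density U * soundSpeed eos U ^ 2 * w i ^ 2 + normSq g
      ≤ C ^ 2 * (density U * normSq w) := spectral_bound_normSq hρ i w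
  have hX : coupling eos i U v B = s * (soundSpeed eos U * density U * w i) + g ⬝ᵥ b := by
    rw [coupling, pressure_eq hU]; ring
  have hcs : coupling eos i U v B ^ 2 ≤ (density U * s ^ 2 + normSq b)
      * (density U * soundSpeed eos U ^ 2 * w i ^ 2 + normSq g) := by
    rw [hX]
    set x := s * (soundSpeed eos U * density U * w i)
    set a := density U * s ^ 2
    set d := density U * soundSpeed eos U ^ 2 * w i ^ 2
    have hx : x ^ 2 = a * d := by simp only [x, a, d]; ring
    have ha : 0 ≤ a := by positivity
    have hd : 0 ≤ d := by positivity
    have hy := dotProduct_sq_le g b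
    have hcross : |2 * x * (g ⬝ᵥ b)| ≤ a * normSq g + d * normSq b := by
      have hg0 := normSq_nonneg g
      have hb0 := normSq_nonneg b
      refine abs_le_of_sq_le_sq ?_ (by positivity)
      have : (2 * x * (g ⬝ᵥ b)) ^ 2 ≤ 4 * (a * d) * (normSq g * normSq b) := by
        rw [mul_pow, mul_pow, hx]
        have : 0 ≤ a * d := by positivity
        nlinarith
      nlinarith [sq_nonneg (a * normSq g - d * normSq b)]
    have := (abs_le.mp hcross).2
    nlinarith
  have hC0 : 0 ≤ C := fastSpeed_nonneg eos i U
  have hb0 := normSq_nonneg b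
  have hQ : 0 ≤ relEnergy U v + normSq b / 2 := by linarith [relEnergy_pos hU v]
  refine abs_le_of_sq_le_sq ?_ (by positivity)
  have hA : 0 ≤ density U * s ^ 2 + normSq b := by positivity
  calc coupling eos i U v B ^ 2
      ≤ (density U * s ^ 2 + normSq b) * (C ^ 2 * (density U * normSq w)) :=
        hcs.trans (mul_le_mul_of_nonneg_left hspec hA)
    _ = C ^ 2 * ((density U * s ^ 2 + normSq b) * (density U * normSq w)) := by ring
    _ ≤ C ^ 2 * (relEnergy U v + normSq b / 2) ^ 2 := by
        refine mul_le_mul_of_nonneg_left ?_ (sq_nonneg C)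
        have : relEnergy U v + normSq b / 2
            = ((density U * s ^ 2 + normSq b) + density U * normSq w) / 2 := by
          rw [hs2, relEnergy]; ring
        rw [this]
        nlinarith [sq_nonneg ((density U * s ^ 2 + normSq b) - density U * normSq w)]
    _ = (C * (relEnergy U v + normSq b / 2)) ^ 2 := by ring

/-! ### The inequality for a pair of states -/

/-- The jump factors as `(B_U - B_V) · (b + d) / 2`, with `b`, `d` the deviations from `B*`. The
`√ρ`-weighted mean velocity makes the other factor a combination of `√ρ (v - v*)_i`, controlled by
kinetic energy; a product of two square roots of energies is bounded by their sum. -/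
lemma abs_magnetic_jump_le {U V : State} (hU : U ∈ admissible) (hV : V ∈ admissible) (i : Fin 3)
    (v B : Fin 3 → ℝ) :
    |(v i - (√(density U) * velocity U i + √(density V) * velocity V i)
          / (√(density U) + √(density V)))
        * (normSq (magnetic U - B) / 2 - normSq (magnetic V - B) / 2)|
      ≤ √(normSq (magnetic U - magnetic V)) / (√(density U) + √(density V))
        * ((relEnergy U v + normSq (magnetic U - B) / 2)
          + (relEnergy V v + normSq (magnetic V - B) / 2)) := by
  have hu := Real.sqrt_pos.mpr hU.1
  have hv := Real.sqrt_pos.mpr hV.1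
  have hu2 := Real.sq_sqrt hU.1.le
  have hv2 := Real.sq_sqrt hV.1.le
  set p := √(density U)
  set q := √(density V)
  set b := magnetic U - B with hb
  set d := magnetic V - B with hd
  set x := p * (velocity U - v) i + q * (velocity V - v) i with hx
  have hdiff : normSq b / 2 - normSq d / 2 = (magnetic U - magnetic V) ⬝ᵥ (b + d) / 2 := by
    simp only [normSq_three, dotProduct_three, hb, hd, Pi.sub_apply, Pi.add_apply]
    ring
  have hvi : v i - (p * velocity U i + q * velocity V i) / (p + q) = -x / (p + q) := by
    rw [hx]; simp only [Pi.sub_apply]; field_simp; ring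
  rw [hdiff, hvi, abs_mul, abs_div, abs_div, abs_neg, abs_of_pos (add_pos hu hv), abs_two]
  set N := √(normSq (magnetic U - magnetic V)) with hN
  have hN0 : 0 ≤ N := Real.sqrt_nonneg _
  have hdot : |(magnetic U - magnetic V) ⬝ᵥ (b + d)| ≤ N * √(normSq (b + d)) := by
    rw [hN, ← Real.sqrt_mul (normSq_nonneg _)]
    exact Real.abs_le_sqrt (dotProduct_sq_le _ _)
  set R := √(normSq (b + d)) with hR
  have hR2 : R ^ 2 = normSq (b + d) := Real.sq_sqrt (normSq_nonneg _)
  have hRle : R ^ 2 ≤ 2 * (normSq b + normSq d) := by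
    rw [hR2]
    simp only [normSq_three, Pi.add_apply]
    nlinarith [sq_nonneg (b 0 - d 0), sq_nonneg (b 1 - d 1), sq_nonneg (b 2 - d 2)]
  have hxle : |x| ^ 2 ≤ 4 * (relEnergy U v + relEnergy V v) := by
    rw [sq_abs]
    have e1 := mul_le_mul_of_nonneg_left (sq_apply_le_normSq (velocity U - v) i) hU.1.le
    have e2 := mul_le_mul_of_nonneg_left (sq_apply_le_normSq (velocity V - v) i) hV.1.le
    have e3 := hU.2
    have e4 := hV.2
    have e5 : x ^ 2 ≤ 2 * (density U * (velocity U - v) i ^ 2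
        + density V * (velocity V - v) i ^ 2) := by
      rw [← hu2, ← hv2, hx]
      nlinarith [sq_nonneg (p * (velocity U - v) i - q * (velocity V - v) i)]
    unfold relEnergy
    linarith
  have hxR : |x| * R ≤ 2 * (relEnergy U v + normSq b / 2 + (relEnergy V v + normSq d / 2)) := by
    nlinarith [sq_nonneg (|x| - R)]
  have hS : 0 < p + q := add_pos hu hv
  calc |x| / (p + q) * (|(magnetic U - magnetic V) ⬝ᵥ (b + d)| / 2)
      ≤ |x| / (p + q) * (N * R / 2) := by gcongr
    _ = N / (p + q) * (|x| * R / 2) := by ring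
    _ ≤ N / (p + q) * (relEnergy U v + normSq b / 2 + (relEnergy V v + normSq d / 2)) := by
        refine mul_le_mul_of_nonneg_left ?_ (div_nonneg hN0 hS.le)
        linarith

lemma abs_velocity_add_fastSpeed_le_alpha (eos : ℝ → ℝ → ℝ) (i : Fin 3) (U V : State) :
    |velocity U i| + fastSpeed eos i U ≤ alpha eos i U V ∧
    |velocity V i| + fastSpeed eos i V ≤ alpha eos i U V := by
  have h : 0 ≤ √(normSq (magnetic U - magnetic V)) / (√(density U) + √(density V)) := by positivity
  unfold alpha
  exact ⟨le_add_of_le_of_nonneg (le_max_left _ _) h,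
    le_add_of_le_of_nonneg ((le_max_left _ _).trans (le_max_right _ _)) h⟩

lemma alpha_pos {eos : ℝ → ℝ → ℝ} (heos : ∀ ρ e : ℝ, 0 < ρ → (0 < eos ρ e ↔ 0 < e))
    {U : State} (hU : U ∈ admissible) (i : Fin 3) (V : State) : 0 < alpha eos i U V :=
  (add_pos_of_nonneg_of_pos (abs_nonneg _) (fastSpeed_pos heos hU i)).trans_le
    (abs_velocity_add_fastSpeed_le_alpha eos i U V).1

/-- The generalized Lax–Friedrichs splitting inequality for a pair of admissible states. -/
theorem flux_sub_flux_dotProduct_nStar_le {eos : ℝ → ℝ → ℝ} {U V : State} (hU : U ∈ admissible)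
    (hV : V ∈ admissible) (i : Fin 3) (v B : Fin 3 → ℝ) {a : ℝ} (ha : alpha eos i U V ≤ a) :
    (flux eos i U - flux eos i V) ⬝ᵥ nStar v B - (v ⬝ᵥ B) * (magnetic U i - magnetic V i)
      ≤ a * ((U ⬝ᵥ nStar v B + normSq B / 2) + (V ⬝ᵥ nStar v B + normSq B / 2)) := by
  have hFU := flux_dotProduct_nStar eos i U hU.1.ne' v B
  have hFV := flux_dotProduct_nStar eos i V hV.1.ne' v B
  rw [dotProduct_nStar U hU.1.ne', dotProduct_nStar V hV.1.ne', sub_dotProduct]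
  have hXU := (abs_le.mp (abs_coupling_le (eos := eos) hU i v B)).2
  have hXV := (abs_le.mp (abs_coupling_le (eos := eos) hV i v B)).1
  have hJ := (abs_le.mp (abs_magnetic_jump_le hU hV i v B)).2
  have hKU := relEnergy_pos hU v
  have hKV := relEnergy_pos hV v
  have hbU : 0 ≤ normSq (magnetic U - B) / 2 := by linarith [normSq_nonneg (magnetic U - B)]
  have hbV : 0 ≤ normSq (magnetic V - B) / 2 := by linarith [normSq_nonneg (magnetic V - B)]
  unfold alpha at ha
  have habs : |√(density U) * velocity U i + √(density V) * velocity V i|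
      / (√(density U) + √(density V))
      = |(√(density U) * velocity U i + √(density V) * velocity V i)
        / (√(density U) + √(density V))| := by
    rw [abs_div, abs_of_nonneg (a := √(density U) + √(density V)) (by positivity)]
  rw [habs] at ha
  set vh := (√(density U) * velocity U i + √(density V) * velocity V i)
    / (√(density U) + √(density V))
  set f := √(normSq (magnetic U - magnetic V)) / (√(density U) + √(density V))
  set CU := fastSpeed eos i U
  set CV := fastSpeed eos i V
  set bU := normSq (magnetic U - B) / 2
  set bV := normSq (magnetic V - B) / 2
  set KU := relEnergy U v
  set KV := relEnergy V v
  set m := max (|velocity U i| + CU) (max (|velocity V i| + CV) (|vh| + max CU CV)) with hm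
  have m1 : |velocity U i| + CU ≤ m := le_max_left _ _
  have m2 : |velocity V i| + CV ≤ m := (le_max_left _ _).trans (le_max_right _ _)
  have m3 : |vh| + max CU CV ≤ m := (le_max_right _ _).trans (le_max_right _ _)
  have m4 := le_max_left CU CV
  have m5 := le_max_right CU CV
  -- By `hJ`, `v*_i (bU - bV)` becomes `vh (bU - bV)` at the cost of the `f` term. Each of the four
  -- energies is then transported with speed at most `m` minus its own fast speed, and that margin
  -- pays for the coupling.
  have t1 : velocity U i * KU ≤ (m - CU) * KU :=
    mul_le_mul_of_nonneg_right ((le_abs_self _).trans (by linarith)) hKU.le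
  have t2 : -velocity V i * KV ≤ (m - CV) * KV :=
    mul_le_mul_of_nonneg_right ((neg_le_abs _).trans (by linarith)) hKV.le
  have t3 : vh * bU ≤ (m - CU) * bU :=
    mul_le_mul_of_nonneg_right ((le_abs_self _).trans (by linarith)) hbU
  have t4 : -vh * bV ≤ (m - CV) * bV :=
    mul_le_mul_of_nonneg_right ((neg_le_abs _).trans (by linarith)) hbV
  have t5 : (m + f) * ((KU + bU) + (KV + bV)) ≤ a * ((KU + bU) + (KV + bV)) :=
    mul_le_mul_of_nonneg_right ha (by linarith)
  nlinarith

lemma flux_dotProduct_n₁ (eos : ℝ → ℝ → ℝ) (i : Fin 3) (U : State) :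
    flux eos i U ⬝ᵥ n₁ = density U * velocity U i := by
  rw [dotProduct_eight]; simp [flux, n₁]

lemma dotProduct_n₁ (U : State) : U ⬝ᵥ n₁ = density U := by
  rw [dotProduct_eight]; simp [n₁, density]

theorem flux_sub_flux_dotProduct_n₁_le {eos : ℝ → ℝ → ℝ} {U V : State} (hU : U ∈ admissible)
    (hV : V ∈ admissible) (i : Fin 3) {a : ℝ} (ha : alpha eos i U V ≤ a) :
    (flux eos i U - flux eos i V) ⬝ᵥ n₁ ≤ a * (U ⬝ᵥ n₁ + V ⬝ᵥ n₁) := by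
  rw [sub_dotProduct, flux_dotProduct_n₁, flux_dotProduct_n₁, dotProduct_n₁, dotProduct_n₁]
  obtain ⟨h1, h2⟩ := abs_velocity_add_fastSpeed_le_alpha eos i U V
  have h3 := fastSpeed_nonneg eos i U
  have h4 := fastSpeed_nonneg eos i V
  have t1 : velocity U i * density U ≤ a * density U :=
    mul_le_mul_of_nonneg_right ((le_abs_self _).trans (by linarith)) hU.1.le
  have t2 : -velocity V i * density V ≤ a * density V :=
    mul_le_mul_of_nonneg_right ((neg_le_abs _).trans (by linarith)) hV.1.le
  linarith

lemma dotProduct_nStar_add_pos {U : State} (hU : U ∈ admissible) (v B : Fin 3 → ℝ) :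
    0 < U ⬝ᵥ nStar v B + normSq B / 2 := by
  rw [dotProduct_nStar U hU.1.ne']
  linarith [relEnergy_pos hU v, normSq_nonneg (magnetic U - B)]

/-- With the state's own velocity and magnetic field both squares vanish, so bounds for all `v*`,
`B*` imply positive internal energy. -/
lemma internalEnergy_eq (U : State) (hρ : density U ≠ 0) :
    internalEnergy U = U ⬝ᵥ nStar (velocity U) (magnetic U) + normSq (magnetic U) / 2 := by
  rw [dotProduct_nStar U hρ, relEnergy, sub_self, sub_self]
  simp [normSq]

end CDG

end

/-! ### Decomposition of the cell average and estimate of one update. -/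

noncomputable section

namespace CDG

open Polynomial

/-! ### Quadrature on the quarters of a cell -/

/-- The rule on `[0, 1]` with nodes `s` and weights `w` is exact in degrees at most `k`. -/
def ExactRule (k : ℕ) (s : Finset ℝ) (w : ℝ → ℝ) : Prop :=
  ∀ f : ℝ[X], f.natDegree ≤ k → unitIntegral f = ∑ ξ ∈ s, w ξ * f.eval ξ

lemma exactRule_gauss (k : ℕ) : ExactRule k (gauss k) (gaussWeight k) :=
  fun _ hf => unitIntegral_eq_gaussWeight_sum hf

lemma exactRule_lobatto (k : ℕ) : ExactRule k (lobatto k) (quadWeight (lobatto k)) :=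
  fun _ hf => unitIntegral_eq_lobattoWeight_sum hf

lemma ExactRule.sum_eq_one {k : ℕ} {s : Finset ℝ} {w : ℝ → ℝ} (h : ExactRule k s w) :
    ∑ ξ ∈ s, w ξ = 1 := by
  have := h 1 (by simp)
  simpa [unitIntegral_one] using this.symm

lemma ExactRule.integral_pow {k : ℕ} {s : Finset ℝ} {w : ℝ → ℝ} (hex : ExactRule k s w)
    (c h : ℝ) (hh : h ≠ 0) {m : ℕ} (hm : m ≤ k) :
    ∫ x in (c + h * 0)..(c + h * 1), x ^ m = h * ∑ ξ ∈ s, w ξ * (c + h * ξ) ^ m := by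
  have hdeg : ((C c + C h * X : ℝ[X]) ^ m).natDegree ≤ k := by
    refine natDegree_pow_le.trans ?_
    have : (C c + C h * X : ℝ[X]).natDegree ≤ 1 := by
      rw [add_comm]; exact natDegree_linear_le
    nlinarith
  have h1 := hex _ hdeg
  simp only [unitIntegral_apply, eval_pow, eval_add, eval_mul, eval_C, eval_X] at h1
  rw [← h1, intervalIntegral.integral_comp_add_mul (fun x => x ^ m) hh c, smul_eq_mul,
    mul_inv_cancel_left₀ hh]

/-- Product quadrature for bivariate polynomials of total degree at most `k`. -/
lemma integral_integral_eval_eq_sum {k : ℕ} {s t : Finset ℝ} {w u : ℝ → ℝ}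
    (hs : ExactRule k s w) (ht : ExactRule k t u) (c h d l : ℝ) (hh : h ≠ 0) (hl : l ≠ 0)
    (P : MvPolynomial (Fin 2) ℝ) (hP : P.totalDegree ≤ k) :
    ∫ x in (c + h * 0)..(c + h * 1), ∫ y in (d + l * 0)..(d + l * 1), MvPolynomial.eval ![x, y] P
      = h * l * ∑ ξ ∈ s, ∑ η ∈ t, w ξ * u η * MvPolynomial.eval ![c + h * ξ, d + l * η] P := by
  -- Total degree at most `k` bounds the degree in each variable by `k`, so the one-dimensional
  -- rules apply monomial by monomial.
  have hdeg : ∀ e ∈ P.support, e 0 ≤ k ∧ e 1 ≤ k := by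
    intro e he
    have := (MvPolynomial.le_totalDegree he).trans hP
    rw [Finsupp.sum_fintype _ _ (fun _ => rfl), Fin.sum_univ_two] at this
    omega
  have heval : ∀ x y, MvPolynomial.eval ![x, y] P
      = ∑ e ∈ P.support, P.coeff e * (x ^ e 0 * y ^ e 1) := by
    intro x y
    rw [MvPolynomial.eval_eq']
    simp [Fin.prod_univ_two]
  have hinner : ∀ x, ∫ y in (d + l * 0)..(d + l * 1), MvPolynomial.eval ![x, y] P
      = ∑ e ∈ P.support, P.coeff e * (x ^ e 0 * (l * ∑ η ∈ t, u η * (d + l * η) ^ e 1)) := by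
    intro x
    simp only [heval]
    rw [intervalIntegral.integral_finsetSum
      (fun e _ => Continuous.intervalIntegrable (by fun_prop) _ _)]
    refine Finset.sum_congr rfl fun e he => ?_
    rw [intervalIntegral.integral_const_mul, intervalIntegral.integral_const_mul,
      ht.integral_pow d l hl (hdeg e he).2]
  simp only [hinner]
  rw [intervalIntegral.integral_finsetSum
    (fun e _ => Continuous.intervalIntegrable (by fun_prop) _ _)]
  simp only [heval]
  have : ∀ e ∈ P.support, (∫ x in (c + h * 0)..(c + h * 1),
      P.coeff e * (x ^ e 0 * (l * ∑ η ∈ t, u η * (d + l * η) ^ e 1)))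
      = h * l * ∑ ξ ∈ s, ∑ η ∈ t, w ξ * u η *
        (P.coeff e * ((c + h * ξ) ^ e 0 * (d + l * η) ^ e 1)) := by
    intro e he
    rw [intervalIntegral.integral_const_mul, intervalIntegral.integral_mul_const,
      hs.integral_pow c h hh (hdeg e he).1]
    calc _ = h * l * P.coeff e * ((∑ ξ ∈ s, w ξ * (c + h * ξ) ^ e 0)
          * ∑ η ∈ t, u η * (d + l * η) ^ e 1) := by ring
      _ = _ := by
        rw [Finset.sum_mul_sum, Finset.mul_sum, Finset.mul_sum]
        refine Finset.sum_congr rfl fun ξ _ => ?_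
        rw [Finset.mul_sum, Finset.mul_sum]
        exact Finset.sum_congr rfl fun η _ => by ring
  rw [Finset.sum_congr rfl this, ← Finset.mul_sum, Finset.sum_comm]
  congr 1
  refine Finset.sum_congr rfl fun ξ _ => ?_
  rw [Finset.sum_comm]
  refine Finset.sum_congr rfl fun η _ => ?_
  rw [Finset.mul_sum]

lemma xNode_eq (M : Mesh) (a : ℝ) (σ : Bool) (ξ : ℝ) :
    M.xNode a σ ξ = M.x (a + sgn σ / 4 - 1 / 4) + M.dx / 2 * ξ := by
  simp only [Mesh.xNode, Mesh.x]; ring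

lemma yNode_eq (M : Mesh) (b : ℝ) (σ : Bool) (ξ : ℝ) :
    M.yNode b σ ξ = M.y (b + sgn σ / 4 - 1 / 4) + M.dy / 2 * ξ := by
  simp only [Mesh.yNode, Mesh.y]; ring

/-- The average of the other solution, by any product rule exact in degrees at most `k`. -/
lemma otherAverage_eq_sum {k : ℕ} {s t : Finset ℝ} {w u : ℝ → ℝ} (hs : ExactRule k s w)
    (ht : ExactRule k t u) (M : Mesh) (a b : ℝ) (Q : Quarters)
    (hQ : ∀ σ τ c, (Q σ τ c).totalDegree ≤ k) :
    otherAverage M a b Q = ∑ σ : Bool, ∑ τ : Bool, ∑ ξ ∈ s, ∑ η ∈ t,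
      (w ξ * u η / 4) • (Q σ τ).val (M.xNode a σ ξ) (M.yNode b τ η) := by
  funext c
  have hx := M.dx_pos.ne'
  have hy := M.dy_pos.ne'
  simp only [otherAverage, Finset.sum_apply, Pi.smul_apply, smul_eq_mul]
  rw [Finset.mul_sum]
  refine Finset.sum_congr rfl fun σ _ => ?_
  rw [Finset.mul_sum]
  refine Finset.sum_congr rfl fun τ _ => ?_
  simp only [xNode_eq, yNode_eq, CellPoly.val]
  rw [integral_integral_eval_eq_sum hs ht _ _ _ _ (by positivity) (by positivity) _ (hQ σ τ c),
    Finset.mul_sum, Finset.mul_sum]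
  refine Finset.sum_congr rfl fun ξ _ => ?_
  rw [Finset.mul_sum, Finset.mul_sum]
  refine Finset.sum_congr rfl fun η _ => ?_
  rw [← mul_assoc, ← mul_assoc]
  congr 1
  field_simp
  ring

/-! ### Averages of affine functionals over lines of Gauss points -/

/-- The Gauss average over the two halves of an edge. -/
def gaussAvg (k : ℕ) (f : Bool → ℝ → ℝ) : ℝ :=
  ∑ σ : Bool, ∑ μ ∈ gauss k, gaussWeight k μ / 2 * f σ μ

lemma gaussAvg_const (k : ℕ) (c : ℝ) : gaussAvg k (fun _ _ => c) = c := by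
  simp only [gaussAvg, ← Finset.sum_mul, ← Finset.sum_div, sum_gaussWeight, Fintype.sum_bool]
  ring

lemma gaussAvg_add (k : ℕ) (f g : Bool → ℝ → ℝ) :
    gaussAvg k (fun σ μ => f σ μ + g σ μ) = gaussAvg k f + gaussAvg k g := by
  simp only [gaussAvg, mul_add, Finset.sum_add_distrib]

lemma gaussAvg_mul (k : ℕ) (r : ℝ) (f : Bool → ℝ → ℝ) :
    gaussAvg k (fun σ μ => r * f σ μ) = r * gaussAvg k f := by
  simp only [gaussAvg, Finset.mul_sum]
  exact Finset.sum_congr rfl fun σ _ => Finset.sum_congr rfl fun μ _ => by ring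

lemma gaussAvg_mono {k : ℕ} {f g : Bool → ℝ → ℝ} (h : ∀ σ, ∀ μ ∈ gauss k, f σ μ ≤ g σ μ) :
    gaussAvg k f ≤ gaussAvg k g :=
  Finset.sum_le_sum fun σ _ => Finset.sum_le_sum fun μ hμ =>
    mul_le_mul_of_nonneg_left (h σ μ hμ) (by linarith [gaussWeight_pos hμ])

lemma gaussAvg_pos {k : ℕ} {f : Bool → ℝ → ℝ} (h : ∀ σ, ∀ μ ∈ gauss k, 0 < f σ μ) :
    0 < gaussAvg k f :=
  Finset.sum_pos (fun σ _ => Finset.sum_pos (fun μ hμ =>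
    mul_pos (by linarith [gaussWeight_pos hμ]) (h σ μ hμ)) (gauss_nonempty k)) Finset.univ_nonempty

lemma gaussSum_dotProduct (k : ℕ) (S : Bool → ℝ → State) (n : State) :
    (∑ σ : Bool, ∑ μ ∈ gauss k, (gaussWeight k μ / 2) • S σ μ) ⬝ᵥ n
      = gaussAvg k fun σ μ => S σ μ ⬝ᵥ n := by
  simp only [gaussAvg, sum_dotProduct, smul_dotProduct, smul_eq_mul]

/-- The Gauss average of `U · n + c` over the line `x = x̂_{a±1/4}^{(ν)}`. -/
def xLineAvg (M : Mesh) (k : ℕ) (a b : ℝ) (Q : Quarters) (n : State) (c ν : ℝ) (s : Bool) : ℝ :=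
  gaussAvg k fun σ μ => (Q s σ).val (M.xNode a s ν) (M.yNode b σ μ) ⬝ᵥ n + c

/-- The Gauss average of `U · n + c` over the line `y = ŷ_{b±1/4}^{(ν)}`. -/
def yLineAvg (M : Mesh) (k : ℕ) (a b : ℝ) (Q : Quarters) (n : State) (c ν : ℝ) (s : Bool) : ℝ :=
  gaussAvg k fun σ μ => (Q σ s).val (M.xNode a σ μ) (M.yNode b s ν) ⬝ᵥ n + c

lemma PiState_dotProduct (M : Mesh) (k : ℕ) (lam₁ lam₂ a b : ℝ) (Q : Quarters) (ν : ℝ) (s : Bool)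
    (n : State) (c : ℝ) (hlam : lam₁ + lam₂ ≠ 0) :
    PiState M k lam₁ lam₂ a b Q ν s ⬝ᵥ n + c
      = lam₁ / (lam₁ + lam₂) * xLineAvg M k a b Q n c ν s
        + lam₂ / (lam₁ + lam₂) * yLineAvg M k a b Q n c ν s := by
  simp only [PiState, xLineAvg, yLineAvg, add_dotProduct, smul_dotProduct, gaussSum_dotProduct,
    gaussAvg_add, gaussAvg_const, smul_eq_mul]
  field_simp
  ring

lemma half_sum_lobattoWeight_mul (k : ℕ) (c : ℝ) :
    1 / 2 * ∑ _s : Bool, ∑ ν ∈ lobatto k, quadWeight (lobatto k) ν * c = c := by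
  simp only [← Finset.sum_mul, (exactRule_lobatto k).sum_eq_one, Fintype.sum_bool]; ring

/-- Lobatto in `x` and Gauss in `y`: the outermost lines then carry precisely the points at which
the `x`-fluxes are evaluated. -/
lemma otherAverage_dotProduct_x (M : Mesh) (k : ℕ) (a b : ℝ) (Q : Quarters)
    (hQ : ∀ σ τ c, (Q σ τ c).totalDegree ≤ k) (n : State) (c : ℝ) :
    otherAverage M a b Q ⬝ᵥ n + c = 1 / 2 * ∑ s : Bool, ∑ ν ∈ lobatto k,
      quadWeight (lobatto k) ν * xLineAvg M k a b Q n c ν s := by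
  have h : otherAverage M a b Q ⬝ᵥ n = 1 / 2 * ∑ s : Bool, ∑ ν ∈ lobatto k,
      quadWeight (lobatto k) ν * gaussAvg k
        fun σ μ => (Q s σ).val (M.xNode a s ν) (M.yNode b σ μ) ⬝ᵥ n := by
    rw [otherAverage_eq_sum (exactRule_lobatto k) (exactRule_gauss k) M a b Q hQ]
    simp only [sum_dotProduct, smul_dotProduct, smul_eq_mul, gaussAvg, Finset.mul_sum]
    refine Finset.sum_congr rfl fun σ _ => ?_
    rw [Finset.sum_comm]
    exact Finset.sum_congr rfl fun ν _ => Finset.sum_congr rfl fun τ _ =>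
      Finset.sum_congr rfl fun μ _ => by ring
  simp only [xLineAvg, gaussAvg_add, gaussAvg_const, mul_add, Finset.sum_add_distrib,
    half_sum_lobattoWeight_mul, h]

lemma otherAverage_dotProduct_y (M : Mesh) (k : ℕ) (a b : ℝ) (Q : Quarters)
    (hQ : ∀ σ τ c, (Q σ τ c).totalDegree ≤ k) (n : State) (c : ℝ) :
    otherAverage M a b Q ⬝ᵥ n + c = 1 / 2 * ∑ s : Bool, ∑ ν ∈ lobatto k,
      quadWeight (lobatto k) ν * yLineAvg M k a b Q n c ν s := by
  have h : otherAverage M a b Q ⬝ᵥ n = 1 / 2 * ∑ s : Bool, ∑ ν ∈ lobatto k,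
      quadWeight (lobatto k) ν * gaussAvg k
        fun σ μ => (Q σ s).val (M.xNode a σ μ) (M.yNode b s ν) ⬝ᵥ n := by
    rw [otherAverage_eq_sum (exactRule_gauss k) (exactRule_lobatto k) M a b Q hQ, Finset.sum_comm]
    simp only [sum_dotProduct, smul_dotProduct, smul_eq_mul, gaussAvg, Finset.mul_sum]
    refine Finset.sum_congr rfl fun τ _ => ?_
    conv_rhs => rw [Finset.sum_comm]
    refine Finset.sum_congr rfl fun σ _ => ?_
    rw [Finset.sum_comm]
    exact Finset.sum_congr rfl fun ν _ => Finset.sum_congr rfl fun μ _ => by ring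
  simp only [yLineAvg, gaussAvg_add, gaussAvg_const, mul_add, Finset.sum_add_distrib,
    half_sum_lobattoWeight_mul, h]

/-- Both tensor rules give the same average, so they may be mixed in the proportion `λ₁ : λ₂`,
matching the sizes of the two flux contributions. -/
lemma otherAverage_dotProduct (M : Mesh) (k : ℕ) (lam₁ lam₂ a b : ℝ) (Q : Quarters)
    (hQ : ∀ σ τ c, (Q σ τ c).totalDegree ≤ k) (n : State) (c : ℝ) (hlam : lam₁ + lam₂ ≠ 0) :
    otherAverage M a b Q ⬝ᵥ n + c = 1 / 2 * ∑ s : Bool, ∑ ν ∈ lobatto k,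
      quadWeight (lobatto k) ν * (PiState M k lam₁ lam₂ a b Q ν s ⬝ᵥ n + c) := by
  have hx := otherAverage_dotProduct_x M k a b Q hQ n c
  have hy := otherAverage_dotProduct_y M k a b Q hQ n c
  have hsplit : otherAverage M a b Q ⬝ᵥ n + c
      = lam₁ / (lam₁ + lam₂) * (otherAverage M a b Q ⬝ᵥ n + c)
        + lam₂ / (lam₁ + lam₂) * (otherAverage M a b Q ⬝ᵥ n + c) := by
    field_simp
  rw [hsplit]
  nth_rewrite 1 [hx]
  nth_rewrite 1 [hy]
  simp only [Finset.mul_sum, ← Finset.sum_add_distrib]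
  refine Finset.sum_congr rfl fun s _ => Finset.sum_congr rfl fun ν _ => ?_
  rw [PiState_dotProduct M k lam₁ lam₂ a b Q ν s n c hlam]
  ring

/-- A sum with the Gauss–Lobatto weights of a nonnegative function dominates its end point part. -/
lemma lobattoWeight₁_mul_le_sum {k : ℕ} {f : ℝ → ℝ} (hf : ∀ ν ∈ lobatto k, 0 ≤ f ν) :
    lobattoWeight₁ k * (f 0 + f 1) ≤ ∑ ν ∈ lobatto k, quadWeight (lobatto k) ν * f ν := by
  have h1 : (1 : ℝ) ∈ (lobatto k).erase 0 :=
    Finset.mem_erase.mpr ⟨one_ne_zero, one_mem_lobatto k⟩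
  rw [← Finset.add_sum_erase _ _ (zero_mem_lobatto k), ← Finset.add_sum_erase _ _ h1,
    lobattoWeight_one]
  have : 0 ≤ ∑ ν ∈ ((lobatto k).erase 0).erase 1, quadWeight (lobatto k) ν * f ν := by
    refine Finset.sum_nonneg fun ν hν => ?_
    simp only [Finset.mem_erase] at hν
    exact mul_nonneg (lobattoWeight_nonneg hν.2.2 hν.2.1 hν.1) (hf ν hν.2.2)
  change _ ≤ lobattoWeight₁ k * f 0 + _
  linarith

/-! ### The update of one cell -/

/-- The right edge is the last Lobatto node of the right half, the left edge the first one of the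
left half, so admissibility at the quadrature points covers the edges. -/
lemma xEdge_eq (M : Mesh) (a b : ℝ) (Q : Quarters) (s σ : Bool) (μ : ℝ) :
    xEdge M a b Q s σ μ
      = (Q s σ).val (M.xNode a s (if s then 1 else 0)) (M.yNode b σ μ) := by
  unfold xEdge Mesh.xNode
  congr 2
  cases s <;> simp [sgn] <;> ring

lemma yEdge_eq (M : Mesh) (a b : ℝ) (Q : Quarters) (s σ : Bool) (μ : ℝ) :
    yEdge M a b Q s σ μ
      = (Q σ s).val (M.xNode a σ μ) (M.yNode b s (if s then 1 else 0)) := by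
  unfold yEdge Mesh.yNode
  congr 2
  cases s <;> simp [sgn] <;> ring

lemma ite_mem_lobatto (k : ℕ) (s : Bool) : (if s then (1 : ℝ) else 0) ∈ lobatto k := by
  cases s
  · simpa using zero_mem_lobatto k
  · simpa using one_mem_lobatto k

lemma xEdge_mem_admissible {M : Mesh} {k : ℕ} {a b : ℝ} {Q : Quarters}
    (h : PointAdmissible M k a b Q) (s σ : Bool) {μ : ℝ} (hμ : μ ∈ gauss k) :
    xEdge M a b Q s σ μ ∈ admissible := by
  rw [xEdge_eq]; exact (h s σ μ hμ _ (ite_mem_lobatto k s)).2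

lemma yEdge_mem_admissible {M : Mesh} {k : ℕ} {a b : ℝ} {Q : Quarters}
    (h : PointAdmissible M k a b Q) (s σ : Bool) {μ : ℝ} (hμ : μ ∈ gauss k) :
    yEdge M a b Q s σ μ ∈ admissible := by
  rw [yEdge_eq]; exact (h σ s μ hμ _ (ite_mem_lobatto k s)).1

/-- The sign of the pressure enters only here: it makes the fast speed, hence `a₁` and `a₂`,
strictly positive. -/
lemma SpeedBound.pos {eos : ℝ → ℝ → ℝ} (heos : ∀ ρ e : ℝ, 0 < ρ → (0 < eos ρ e ↔ 0 < e))
    {M : Mesh} {k : ℕ} {a b : ℝ} {Q : Quarters} {a₁ a₂ : ℝ} (h : PointAdmissible M k a b Q)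
    (hsp : SpeedBound eos M k a b Q a₁ a₂) : 0 < a₁ ∧ 0 < a₂ := by
  obtain ⟨μ, hμ⟩ := gauss_nonempty k
  obtain ⟨h1, h2⟩ := hsp true μ hμ
  exact ⟨(alpha_pos heos (xEdge_mem_admissible h _ _ hμ) _ _).trans_le h1,
    (alpha_pos heos (yEdge_mem_admissible h _ _ hμ) _ _).trans_le h2⟩

/-- The affine functional `U ↦ U · n + c` is positive on admissible states and satisfies the
splitting inequality with the magnetic correction factor `r`. -/
structure IsSplitting (eos : ℝ → ℝ → ℝ) (n : State) (c r : ℝ) : Prop where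
  pos : ∀ U ∈ admissible, 0 < U ⬝ᵥ n + c
  flux_le : ∀ U ∈ admissible, ∀ V ∈ admissible, ∀ (i : Fin 3) (a : ℝ), alpha eos i U V ≤ a →
    (flux eos i U - flux eos i V) ⬝ᵥ n + -r * (magnetic U i - magnetic V i)
      ≤ a * ((U ⬝ᵥ n + c) + (V ⬝ᵥ n + c))

lemma isSplitting_n₁ (eos : ℝ → ℝ → ℝ) : IsSplitting eos n₁ 0 0 where
  pos U hU := by rw [dotProduct_n₁, add_zero]; exact hU.1
  flux_le U hU V hV i a ha := by
    have := flux_sub_flux_dotProduct_n₁_le hU hV i ha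
    linarith

lemma isSplitting_nStar (eos : ℝ → ℝ → ℝ) (v B : Fin 3 → ℝ) :
    IsSplitting eos (nStar v B) (normSq B / 2) (v ⬝ᵥ B) where
  pos U hU := dotProduct_nStar_add_pos hU v B
  flux_le U hU V hV i a ha := by
    have := flux_sub_flux_dotProduct_nStar_le hU hV i v B ha
    linarith

lemma PiState_dotProduct_pos {M : Mesh} {k : ℕ} {lam₁ lam₂ a b : ℝ} {Q : Quarters} {n : State}
    {c : ℝ} (hpos : ∀ U ∈ admissible, 0 < U ⬝ᵥ n + c) (hpt : PointAdmissible M k a b Q)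
    (hlam₁ : 0 < lam₁) (hlam₂ : 0 < lam₂) {ν : ℝ} (hν : ν ∈ lobatto k) (s : Bool) :
    0 < PiState M k lam₁ lam₂ a b Q ν s ⬝ᵥ n + c := by
  rw [PiState_dotProduct M k lam₁ lam₂ a b Q ν s n c (by positivity)]
  have h1 : 0 < xLineAvg M k a b Q n c ν s :=
    gaussAvg_pos fun σ μ hμ => hpos _ (hpt s σ μ hμ ν hν).2
  have h2 : 0 < yLineAvg M k a b Q n c ν s :=
    gaussAvg_pos fun σ μ hμ => hpos _ (hpt σ s μ hμ ν hν).1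
  positivity

/-- The splitting inequality averaged over pairs of opposite Gauss points; the magnetic jumps add up
to the `x`-part of the discrete divergence. -/
lemma xFlux_gaussAvg_le {eos : ℝ → ℝ → ℝ} {M : Mesh} {k : ℕ} {a b a₁ a₂ : ℝ} {Q : Quarters}
    {n : State} {c r : ℝ} (hn : IsSplitting eos n c r) (hpt : PointAdmissible M k a b Q)
    (hsp : SpeedBound eos M k a b Q a₁ a₂) :
    (∑ σ : Bool, ∑ μ ∈ gauss k, (gaussWeight k μ / 2) •
        (flux eos 0 (xEdge M a b Q true σ μ) - flux eos 0 (xEdge M a b Q false σ μ))) ⬝ᵥ n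
      ≤ r * (∑ σ : Bool, ∑ μ ∈ gauss k, gaussWeight k μ / 2 *
          (magnetic (xEdge M a b Q true σ μ) 0 - magnetic (xEdge M a b Q false σ μ) 0))
        + a₁ * (xLineAvg M k a b Q n c 1 true + xLineAvg M k a b Q n c 0 false) := by
  have h := gaussAvg_mono (k := k) fun σ μ hμ => hn.flux_le _
    (xEdge_mem_admissible hpt true σ hμ) _ (xEdge_mem_admissible hpt false σ hμ) 0 a₁
    (hsp σ μ hμ).1
  rw [gaussAvg_add, gaussAvg_mul, gaussAvg_mul, gaussAvg_add] at h
  rw [gaussSum_dotProduct]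
  simp only [xEdge_eq M a b Q, if_true, Bool.false_eq_true, if_false] at h ⊢
  unfold xLineAvg
  rw [show ∀ f : Bool → ℝ → ℝ, (∑ σ : Bool, ∑ μ ∈ gauss k, gaussWeight k μ / 2 * f σ μ)
    = gaussAvg k f from fun _ => rfl]
  linarith

lemma yFlux_gaussAvg_le {eos : ℝ → ℝ → ℝ} {M : Mesh} {k : ℕ} {a b a₁ a₂ : ℝ} {Q : Quarters}
    {n : State} {c r : ℝ} (hn : IsSplitting eos n c r) (hpt : PointAdmissible M k a b Q)
    (hsp : SpeedBound eos M k a b Q a₁ a₂) :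
    (∑ σ : Bool, ∑ μ ∈ gauss k, (gaussWeight k μ / 2) •
        (flux eos 1 (yEdge M a b Q true σ μ) - flux eos 1 (yEdge M a b Q false σ μ))) ⬝ᵥ n
      ≤ r * (∑ σ : Bool, ∑ μ ∈ gauss k, gaussWeight k μ / 2 *
          (magnetic (yEdge M a b Q true σ μ) 1 - magnetic (yEdge M a b Q false σ μ) 1))
        + a₂ * (yLineAvg M k a b Q n c 1 true + yLineAvg M k a b Q n c 0 false) := by
  have h := gaussAvg_mono (k := k) fun σ μ hμ => hn.flux_le _
    (yEdge_mem_admissible hpt true σ hμ) _ (yEdge_mem_admissible hpt false σ hμ) 1 a₂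
    (hsp σ μ hμ).2
  rw [gaussAvg_add, gaussAvg_mul, gaussAvg_mul, gaussAvg_add] at h
  rw [gaussSum_dotProduct]
  simp only [yEdge_eq M a b Q, if_true, Bool.false_eq_true, if_false] at h ⊢
  unfold yLineAvg
  rw [show ∀ f : Bool → ℝ → ℝ, (∑ σ : Bool, ∑ μ ∈ gauss k, gaussWeight k μ / 2 * f σ μ)
    = gaussAvg k f from fun _ => rfl]
  linarith

/-- The lower bound for the updated cell average, for a general splitting functional. -/
theorem updated_dotProduct_gt {eos : ℝ → ℝ → ℝ}
    (heos : ∀ ρ e : ℝ, 0 < ρ → (0 < eos ρ e ↔ 0 < e)) {M : Mesh} {k : ℕ}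
    {Δt τmax θ a₁ a₂ lam₁ lam₂ a b : ℝ} {P : CellPoly} {Q : Quarters}
    (hQ : ∀ σ τ c, (Q σ τ c).totalDegree ≤ k) (hΔt : 0 < Δt)
    (hθ : θ = Δt / τmax) (hθ0 : 0 < θ) (hθ1 : θ ≤ 1)
    (hlam₁ : lam₁ = a₁ * Δt / M.dx) (hlam₂ : lam₂ = a₂ * Δt / M.dy)
    (havg : ownAverage M a b P ∈ admissible) (hpt : PointAdmissible M k a b Q)
    (hsp : SpeedBound eos M k a b Q a₁ a₂)
    (hCFL : lam₁ + lam₂ < θ * lobattoWeight₁ k / 2)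
    {n : State} {c r : ℝ} (hn : IsSplitting eos n c r) :
    updated eos M k Δt τmax a b P Q ⬝ᵥ n + c
        > θ * lobattoWeight₁ k / 2 *
            ((PiState M k lam₁ lam₂ a b Q 1 false ⬝ᵥ n + c)
              + (PiState M k lam₁ lam₂ a b Q 0 true ⬝ᵥ n + c))
          - Δt * r * discreteDiv M k a b Q ∧
    0 < θ * lobattoWeight₁ k / 2 *
            ((PiState M k lam₁ lam₂ a b Q 1 false ⬝ᵥ n + c)
              + (PiState M k lam₁ lam₂ a b Q 0 true ⬝ᵥ n + c)) := by
  have hdx := M.dx_pos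
  have hdy := M.dy_pos
  obtain ⟨ha₁, ha₂⟩ := SpeedBound.pos heos hpt hsp
  have hl₁ : 0 < lam₁ := by rw [hlam₁]; positivity
  have hl₂ : 0 < lam₂ := by rw [hlam₂]; positivity
  have hlam : lam₁ + lam₂ ≠ 0 := by positivity
  have hPi : ∀ ν ∈ lobatto k, ∀ s, 0 < PiState M k lam₁ lam₂ a b Q ν s ⬝ᵥ n + c :=
    fun ν hν s => PiState_dotProduct_pos hn.pos hpt hl₁ hl₂ hν s
  have hown := hn.pos _ havg
  have hother := otherAverage_dotProduct M k lam₁ lam₂ a b Q hQ n c hlam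
  have ht := lobattoWeight₁_mul_le_sum (k := k)
    (f := fun ν => PiState M k lam₁ lam₂ a b Q ν true ⬝ᵥ n + c) fun ν hν => (hPi ν hν true).le
  have hf := lobattoWeight₁_mul_le_sum (k := k)
    (f := fun ν => PiState M k lam₁ lam₂ a b Q ν false ⬝ᵥ n + c) fun ν hν => (hPi ν hν false).le
  have p1t := hPi 1 (one_mem_lobatto k) true
  have p0t := hPi 0 (zero_mem_lobatto k) true
  have p1f := hPi 1 (one_mem_lobatto k) false
  have p0f := hPi 0 (zero_mem_lobatto k) false
  have e1t := PiState_dotProduct M k lam₁ lam₂ a b Q 1 true n c hlam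
  have e0f := PiState_dotProduct M k lam₁ lam₂ a b Q 0 false n c hlam
  have hX := xFlux_gaussAvg_le hn hpt hsp
  have hY := yFlux_gaussAvg_le hn hpt hsp
  rw [Fintype.sum_bool] at hother
  have hdiv : discreteDiv M k a b Q = 1 / M.dx * (∑ σ : Bool, ∑ μ ∈ gauss k, gaussWeight k μ / 2 *
      (magnetic (xEdge M a b Q true σ μ) 0 - magnetic (xEdge M a b Q false σ μ) 0))
    + 1 / M.dy * (∑ σ : Bool, ∑ μ ∈ gauss k, gaussWeight k μ / 2 *
      (magnetic (yEdge M a b Q true σ μ) 1 - magnetic (yEdge M a b Q false σ μ) 1)) := rfl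
  set D₁ := ∑ σ : Bool, ∑ μ ∈ gauss k, gaussWeight k μ / 2 *
      (magnetic (xEdge M a b Q true σ μ) 0 - magnetic (xEdge M a b Q false σ μ) 0)
  set D₂ := ∑ σ : Bool, ∑ μ ∈ gauss k, gaussWeight k μ / 2 *
      (magnetic (yEdge M a b Q true σ μ) 1 - magnetic (yEdge M a b Q false σ μ) 1)
  set S₁ := ∑ σ : Bool, ∑ μ ∈ gauss k, (gaussWeight k μ / 2) •
        (flux eos 0 (xEdge M a b Q true σ μ) - flux eos 0 (xEdge M a b Q false σ μ)) with hS₁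
  set S₂ := ∑ σ : Bool, ∑ μ ∈ gauss k, (gaussWeight k μ / 2) •
        (flux eos 1 (yEdge M a b Q true σ μ) - flux eos 1 (yEdge M a b Q false σ μ)) with hS₂
  have hup : updated eos M k Δt τmax a b P Q ⬝ᵥ n + c
      = (1 - θ) * (ownAverage M a b P ⬝ᵥ n + c) + θ * (otherAverage M a b Q ⬝ᵥ n + c)
        - Δt / M.dx * (S₁ ⬝ᵥ n) - Δt / M.dy * (S₂ ⬝ᵥ n) := by
    simp only [updated, schemeOp, ← hS₁, ← hS₂, add_dotProduct, sub_dotProduct, smul_dotProduct,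
      smul_eq_mul, hθ]
    ring
  set g1t := PiState M k lam₁ lam₂ a b Q 1 true ⬝ᵥ n + c
  set g0t := PiState M k lam₁ lam₂ a b Q 0 true ⬝ᵥ n + c
  set g1f := PiState M k lam₁ lam₂ a b Q 1 false ⬝ᵥ n + c
  set g0f := PiState M k lam₁ lam₂ a b Q 0 false ⬝ᵥ n + c
  set ω := lobattoWeight₁ k
  have hX' : Δt / M.dx * (S₁ ⬝ᵥ n) ≤ Δt / M.dx * (r * D₁)
      + lam₁ * (xLineAvg M k a b Q n c 1 true + xLineAvg M k a b Q n c 0 false) := by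
    refine (mul_le_mul_of_nonneg_left hX (by positivity)).trans_eq ?_
    rw [hlam₁]; ring
  have hY' : Δt / M.dy * (S₂ ⬝ᵥ n) ≤ Δt / M.dy * (r * D₂)
      + lam₂ * (yLineAvg M k a b Q n c 1 true + yLineAvg M k a b Q n c 0 false) := by
    refine (mul_le_mul_of_nonneg_left hY (by positivity)).trans_eq ?_
    rw [hlam₂]; ring
  -- The proportion `λ₁ : λ₂` in `Π` turns the edge terms of both directions into `λ` times the two
  -- outer end states.
  have hend : lam₁ * (xLineAvg M k a b Q n c 1 true + xLineAvg M k a b Q n c 0 false)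
      + lam₂ * (yLineAvg M k a b Q n c 1 true + yLineAvg M k a b Q n c 0 false)
      = (lam₁ + lam₂) * (g1t + g0f) := by
    rw [e1t, e0f]
    field_simp
    ring
  have hcfl : (lam₁ + lam₂) * (g1t + g0f) < θ * ω / 2 * (g1t + g0f) :=
    mul_lt_mul_of_pos_right hCFL (by positivity)
  have hth : θ * (1 / 2 * (ω * (g0t + g1t) + ω * (g0f + g1f)))
      ≤ θ * (otherAverage M a b Q ⬝ᵥ n + c) := by
    refine mul_le_mul_of_nonneg_left ?_ hθ0.le
    rw [hother]
    linarith
  -- Positivity of the end weight is read off from the CFL condition.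
  have hw : 0 < θ * ω / 2 := (add_pos hl₁ hl₂).trans hCFL
  have ho : 0 ≤ (1 - θ) * (ownAverage M a b P ⬝ᵥ n + c) :=
    mul_nonneg (by linarith) hown.le
  have hdiv' : Δt * r * discreteDiv M k a b Q
      = Δt / M.dx * (r * D₁) + Δt / M.dy * (r * D₂) := by
    rw [hdiv]; ring
  refine ⟨?_, by positivity⟩
  rw [gt_iff_lt, hup, hdiv']
  linarith

/-- The conclusions for one updated cell. -/
theorem updated_bounds {eos : ℝ → ℝ → ℝ}
    (heos : ∀ ρ e : ℝ, 0 < ρ → (0 < eos ρ e ↔ 0 < e)) {M : Mesh} {k : ℕ}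
    {Δt τmax θ a₁ a₂ lam₁ lam₂ a b : ℝ} {P : CellPoly} {Q : Quarters}
    (hQ : ∀ σ τ c, (Q σ τ c).totalDegree ≤ k) (hΔt : 0 < Δt)
    (hθ : θ = Δt / τmax) (hθ0 : 0 < θ) (hθ1 : θ ≤ 1)
    (hlam₁ : lam₁ = a₁ * Δt / M.dx) (hlam₂ : lam₂ = a₂ * Δt / M.dy)
    (havg : ownAverage M a b P ∈ admissible) (hpt : PointAdmissible M k a b Q)
    (hsp : SpeedBound eos M k a b Q a₁ a₂)
    (hCFL : lam₁ + lam₂ < θ * lobattoWeight₁ k / 2) :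
    (0 < updated eos M k Δt τmax a b P Q ⬝ᵥ n₁ ∧
      ∀ v B : Fin 3 → ℝ,
        updated eos M k Δt τmax a b P Q ⬝ᵥ nStar v B + normSq B / 2
          > θ * lobattoWeight₁ k / 2 *
              ((PiState M k lam₁ lam₂ a b Q 1 false + PiState M k lam₁ lam₂ a b Q 0 true)
                ⬝ᵥ nStar v B + normSq B)
            - Δt * (v ⬝ᵥ B) * discreteDiv M k a b Q) ∧
    (discreteDiv M k a b Q = 0 → updated eos M k Δt τmax a b P Q ∈ admissible) := by
  have key {n : State} {c r : ℝ} (hn : IsSplitting eos n c r) :=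
    updated_dotProduct_gt heos hQ hΔt hθ hθ0 hθ1 hlam₁ hlam₂ havg hpt hsp hCFL hn
  -- For the density `r = 0`, so no condition on the divergence is needed.
  have h1 : 0 < updated eos M k Δt τmax a b P Q ⬝ᵥ n₁ := by
    obtain ⟨h, h'⟩ := key (isSplitting_n₁ eos)
    linarith
  refine ⟨⟨h1, fun v B => ?_⟩, fun hdiv => ?_⟩
  · have h := (key (isSplitting_nStar eos v B)).1
    rw [add_dotProduct]
    -- The two copies of `|B*|²/2`, one for each inner `Π`, add up to `|B*|²`.
    convert h using 3
    ring
  · rw [dotProduct_n₁] at h1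
    refine ⟨h1, ?_⟩
    rw [internalEnergy_eq _ h1.ne']
    -- Here `v*` and `B*` are those of the updated average itself. Since `v*·B*` has no sign, the
    -- divergence must vanish.
    obtain ⟨h, h'⟩ := key (isSplitting_nStar eos
      (velocity (updated eos M k Δt τmax a b P Q)) (magnetic (updated eos M k Δt τmax a b P Q)))
    rw [hdiv] at h
    linarith

end CDG

end

/-- `cellsC` and `cellsD` are the index sets of the primal cells `I_{i,j}` and of the dual cells
`I_{i+1/2,j+1/2}` that are updated; cells outside these sets only serve as neighbours (ghost cells),
and both sets may be everything. -/
theorem theorem4p1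
    (eos : ℝ → ℝ → ℝ) (heos : ∀ ρ e : ℝ, 0 < ρ → (0 < eos ρ e ↔ 0 < e))
    (M : CDG.Mesh) (k : ℕ) (cellsC cellsD : Set (ℤ × ℤ))
    (UC UD : ℤ → ℤ → CDG.CellPoly) (hUC : UC ∈ CDG.DGSpace k) (hUD : UD ∈ CDG.DGSpace k)
    (Δt τmax θ a₁ a₂ lam₁ lam₂ : ℝ) (hΔt : 0 < Δt)
    (hθ : θ = Δt / τmax) (hθ0 : 0 < θ) (hθ1 : θ ≤ 1)
    (hlam₁ : lam₁ = a₁ * Δt / M.dx) (hlam₂ : lam₂ = a₂ * Δt / M.dy)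
    -- the cell averages are admissible
    (havgC : ∀ i j : ℤ, (i, j) ∈ cellsC → CDG.ownAverage M i j (UC i j) ∈ CDG.admissible)
    (havgD : ∀ i j : ℤ, (i, j) ∈ cellsD →
      CDG.ownAverage M ((i : ℝ) + 1 / 2) ((j : ℝ) + 1 / 2) (UD i j) ∈ CDG.admissible)
    -- the solutions are admissible at the quadrature points
    (hptD : ∀ i j : ℤ, (i, j) ∈ cellsC → CDG.PointAdmissible M k i j (CDG.dualOnPrimal UD i j))
    (hptC : ∀ i j : ℤ, (i, j) ∈ cellsD →
      CDG.PointAdmissible M k ((i : ℝ) + 1 / 2) ((j : ℝ) + 1 / 2) (CDG.primalOnDual UC i j))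
    -- the wave speed estimates
    (hspD : ∀ i j : ℤ, (i, j) ∈ cellsC → CDG.SpeedBound eos M k i j (CDG.dualOnPrimal UD i j) a₁ a₂)
    (hspC : ∀ i j : ℤ, (i, j) ∈ cellsD →
      CDG.SpeedBound eos M k ((i : ℝ) + 1 / 2) ((j : ℝ) + 1 / 2) (CDG.primalOnDual UC i j) a₁ a₂)
    -- the CFL condition
    (hCFL : lam₁ + lam₂ < θ * CDG.lobattoWeight₁ k / 2) :
    -- primal cells
    (∀ i j : ℤ, (i, j) ∈ cellsC →
      0 < CDG.updated eos M k Δt τmax i j (UC i j) (CDG.dualOnPrimal UD i j) ⬝ᵥ CDG.n₁ ∧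
      ∀ v B : Fin 3 → ℝ,
        CDG.updated eos M k Δt τmax i j (UC i j) (CDG.dualOnPrimal UD i j) ⬝ᵥ CDG.nStar v B
            + CDG.normSq B / 2
          > θ * CDG.lobattoWeight₁ k / 2 *
              ((CDG.PiState M k lam₁ lam₂ i j (CDG.dualOnPrimal UD i j) 1 false
                  + CDG.PiState M k lam₁ lam₂ i j (CDG.dualOnPrimal UD i j) 0 true)
                ⬝ᵥ CDG.nStar v B + CDG.normSq B)
            - Δt * (v ⬝ᵥ B) * CDG.discreteDiv M k i j (CDG.dualOnPrimal UD i j)) ∧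
    -- dual cells
    (∀ i j : ℤ, (i, j) ∈ cellsD →
      0 < CDG.updated eos M k Δt τmax ((i : ℝ) + 1 / 2) ((j : ℝ) + 1 / 2) (UD i j)
            (CDG.primalOnDual UC i j) ⬝ᵥ CDG.n₁ ∧
      ∀ v B : Fin 3 → ℝ,
        CDG.updated eos M k Δt τmax ((i : ℝ) + 1 / 2) ((j : ℝ) + 1 / 2) (UD i j)
            (CDG.primalOnDual UC i j) ⬝ᵥ CDG.nStar v B + CDG.normSq B / 2
          > θ * CDG.lobattoWeight₁ k / 2 *
              ((CDG.PiState M k lam₁ lam₂ ((i : ℝ) + 1 / 2) ((j : ℝ) + 1 / 2)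
                    (CDG.primalOnDual UC i j) 1 false
                  + CDG.PiState M k lam₁ lam₂ ((i : ℝ) + 1 / 2) ((j : ℝ) + 1 / 2)
                    (CDG.primalOnDual UC i j) 0 true)
                ⬝ᵥ CDG.nStar v B + CDG.normSq B)
            - Δt * (v ⬝ᵥ B) *
                CDG.discreteDiv M k ((i : ℝ) + 1 / 2) ((j : ℝ) + 1 / 2) (CDG.primalOnDual UC i j)) ∧
    -- positivity under the discrete divergence-free condition
    ((∀ i j : ℤ, (i, j) ∈ cellsC → CDG.discreteDiv M k i j (CDG.dualOnPrimal UD i j) = 0) →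
      (∀ i j : ℤ, (i, j) ∈ cellsD →
        CDG.discreteDiv M k ((i : ℝ) + 1 / 2) ((j : ℝ) + 1 / 2) (CDG.primalOnDual UC i j) = 0) →
      (∀ i j : ℤ, (i, j) ∈ cellsC →
        CDG.updated eos M k Δt τmax i j (UC i j) (CDG.dualOnPrimal UD i j) ∈ CDG.admissible) ∧
      (∀ i j : ℤ, (i, j) ∈ cellsD →
        CDG.updated eos M k Δt τmax ((i : ℝ) + 1 / 2) ((j : ℝ) + 1 / 2) (UD i j)
          (CDG.primalOnDual UC i j) ∈ CDG.admissible)) := by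
  -- Both meshes obey the same one-cell estimate with the two solutions interchanged.
  have hC := fun i j (h : (i, j) ∈ cellsC) =>
    CDG.updated_bounds heos (fun _ _ c => hUD _ _ c) hΔt hθ hθ0 hθ1 hlam₁ hlam₂ (havgC i j h)
      (hptD i j h) (hspD i j h) hCFL
  have hD := fun i j (h : (i, j) ∈ cellsD) =>
    CDG.updated_bounds heos (fun _ _ c => hUC _ _ c) hΔt hθ hθ0 hθ1 hlam₁ hlam₂ (havgD i j h)
      (hptC i j h) (hspC i j h) hCFL
  exact ⟨fun i j h => (hC i j h).1, fun i j h => (hD i j h).1, fun hdC hdD =>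
    ⟨fun i j h => (hC i j h).2 (hdC i j h), fun i j h => (hD i j h).2 (hdD i j h)⟩⟩
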